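/- **Setting.** Let $K$ be a pure simplicial complex of dimension $n-1$ (for instance a PL sphere) with vertex set $[m]=\{1,\dots,m\}$. A (mod $2$) characteristic map over $K$ is a map $\lambda:[m]\to\mathbb Z_2^n$, also viewed as the $n\times m$ matrix with columns $\lambda(v)$, such that $\lambda(i_1),\dots,\lambda(i_n)$ are linearly independent whenever $\{i_1,\dots,i_n\}$ is a face of $K$ with $n$ elements. $CM(K)$ is the set of characteristic maps over $K$ modulo left multiplication by $GL_n(\mathbb Z_2)$. For a vertex $p$, $\mathrm{wed}_p(K)=(I*\mathrm{Lk}_K(p))\cup(\partial I*(K\setminus p))$, with $I$ the $1$-simplex on two new vertices $p_1,p_2$ replacing $p$; for $p\ne q$, $\mathrm{wed}_{p,q}(K)=\mathrm{wed}_q(\mathrm{wed}_p(K))$. For a face $\sigma$, $\mathrm{Proj}_\sigma\lambda$ is the class of the map $s\mapsto[\lambda(s)]\in\mathbb Z_2^n/\langle\lambda(v):v\in\sigma\rangle$ on the vertices of $\mathrm{Lk}(\sigma)$. The link in $\mathrm{wed}_p(K)$ of one copy of $p$ is identified with $K$ by letting the other copy play the role of $p$; likewise for the link in $\mathrm{wed}_{p,q}(K)$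 of an edge $\{p_i,q_j\}$. Two classes $\lambda_1,\lambda_2\in CM(K)$ are joined by a *$p$-edge* if there is $\Lambda\in CM(\mathrm{wed}_p(K))$ with $\mathrm{Proj}_{p_2}\Lambda=\lambda_1$ and $\mathrm{Proj}_{p_1}\Lambda=\lambda_2$. A class $S\in CM(\mathrm{wed}_{p,q}(K))$ is called a *realizable square*; its corners are $\lambda=\mathrm{Proj}_{p_2,q_2}S$, $\lambda^\alpha=\mathrm{Proj}_{p_1,q_2}S$, $\lambda^\beta=\mathrm{Proj}_{p_2,q_1}S$, $\lambda^\gamma=\mathrm{Proj}_{p_1,q_1}S$. An *incomplete $pq$-square* ($p\neq q$) consists of $\lambda,\lambda^\alpha,\lambda^\beta\in CM(K)$ with a $p$-edge joining $\lambda,\lambda^\alpha$ and a $q$-edge joining $\lambda,\lambda^\beta$. A *possible missing piece* is a class $\lambda^\gamma\in CM(K)$ joined to $\lambda^\alpha$ by a $q$-edge and to $\lambda^\beta$ by a $p$-edge; it is a *missing piece* if moreover $(\lambda,\lambda^\alpha,\lambda^\beta,\lambda^\gamma)$ are the corners of a realizable square. Label the vertices so that $\{1,\dots,n\}\in K$.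 Then every class in $CM(K)$ has a unique representative $\lambda=(I_n\mid M)$; below $\lambda(v)$ denotes the columns of this representative, and $\bar\lambda=\binom{M}{I_{m-n}}$ its dual, an $m\times(m-n)$ matrix. For a row vector $\psi\in\mathbb Z_2^{m-n}$, with coordinates indexed by $n+1,\dots,m$ and extended by $\psi(v)=0$ for $v\le n$, let $(p,\lambda,\psi)$ be the $m\times m$ matrix $\begin{pmatrix}I_n&\lambda(p)\,\psi\\0&I_{m-n}\end{pmatrix}$. **Statement.** Let $p\neq q$ be vertices of $K$. (A) Let $\lambda,\lambda^\alpha,\lambda^\beta$ be an incomplete $pq$-square. 1. If there is no possible missing piece, the square cannot be completed: no realizable square has these three corners. 2. If there is a possible missing piece, then there is exactly one missing piece $\lambda^\gamma$, and exactly one realizable square with corners $\lambda,\lambda^\alpha,\lambda^\beta,\lambda^\gamma$. If there is only one possible missing piece, it is the missing piece. If there is more than one, then $\lambda(p)=\lambda(q)$. 3. There are unique row vectors $\phi,\psi$ with $\bar\lambda^\alpha=\alpha\bar\lambda$ and $\bar\lambda^\beta=\beta\bar\lambda$, where $\alpha=(p,\lambda,\phi)$ and $\beta=(q,\lambda,\psi)$.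 A class $\lambda^\gamma\in CM(K)$ is the missing piece if and only if $$\bar\lambda^\gamma=\bigl(q,\lambda^\alpha,\ \psi+\psi(p)\phi\bigr)\,\alpha\,\bar\lambda .$$ If $\lambda(p)=\lambda(q)$, then the missing piece exists and $\bar\lambda^\gamma=\alpha\beta\bar\lambda$. If $p,q\in\{1,\dots,n\}$, then the missing piece, if it exists, is also given by $\bar\lambda^\gamma=\alpha\beta\bar\lambda$. (B) The realizable squares are computable from $CM(K)$ alone. Precisely, $\lambda\mapsto\bar\lambda$ is injective on $CM(K)$; let $D$ be its (finite) image. Sending $S\in CM(\mathrm{wed}_{p,q}(K))$ to the quadruple of the dual matrices of its four corners is a well-defined bijection from $CM(\mathrm{wed}_{p,q}(K))$ onto the explicitly computable finite set of all $(L,L^\alpha,L^\beta,L^\gamma)\in D^4$ for which there are row vectors $\phi,\psi$ with $L^\alpha=(p,L,\phi)L$, $L^\beta=(q,L,\psi)L$ and $L^\gamma=(q,L^\alpha,\psi+\psi(p)\phi)L^\alpha$ (here $(p,L,\phi)$ means $(p,\lambda,\phi)$ with $\bar\lambda=L$). -/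

import Mathlib

open Matrix

namespace Puzzle

/-! ### Simplicial complexes: link, deletion, wedge -/

section Complexes

variable {V : Type*}

/-- `s` is a simplex of `K`, the empty simplex included. -/
def IsSimplex (K : AbstractSimplicialComplex V) (s : Finset V) : Prop :=
  s = ∅ ∨ s ∈ K.faces

/-- `K` is pure of dimension `n - 1`: all its maximal faces have exactly `n` vertices. -/
def IsPure (K : AbstractSimplicialComplex V) (n : ℕ) : Prop :=
  ∀ s ∈ K.faces, s.card ≤ n ∧ ∃ t ∈ K.faces, s ⊆ t ∧ t.card = n

lemma IsSimplex.mono {K : AbstractSimplicialComplex V} {s t : Finset V}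
    (hs : IsSimplex K s) (h : t ⊆ s) : IsSimplex K t := by
  rcases t.eq_empty_or_nonempty with rfl | ht
  · exact Or.inl rfl
  · rcases hs with rfl | hs
    · exact absurd (Finset.subset_empty.mp h) ht.ne_empty
    · exact Or.inr ((K.isRelLowerSet_faces hs).2 h ht)

/-- The vertex set `(V ∖ {p}) ∪ {p₁, p₂}`; here `p₁ = inr 0` and `p₂ = inr 1`. -/
abbrev WedgeVertex (V : Type*) (p : V) : Type _ := {u : V // u ≠ p} ⊕ Fin 2

/-- The part of `s ⊆ (V ∖ {p}) ∪ {p₁, p₂}` that lies in `V ∖ {p}`, as a subset of `V`. -/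
def basePart (p : V) (s : Finset (WedgeVertex V p)) : Finset V :=
  s.toLeft.map (Function.Embedding.subtype _)

lemma mem_basePart {p : V} {s : Finset (WedgeVertex V p)} {u : V} :
    u ∈ basePart p s ↔ ∃ h : u ≠ p, Sum.inl ⟨u, h⟩ ∈ s := by
  simp [basePart]

lemma basePart_mono (p : V) {s t : Finset (WedgeVertex V p)} (h : s ⊆ t) :
    basePart p s ⊆ basePart p t := by
  intro u hu
  rw [mem_basePart] at hu ⊢
  exact hu.imp fun _ hs => h hs

variable [DecidableEq V]

/-- The link of `σ` in `K` (as a set of simplices, the empty one included). -/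
def link (K : AbstractSimplicialComplex V) (σ : Finset V) : Set (Finset V) :=
  {τ | IsSimplex K τ ∧ IsSimplex K (σ ∪ τ) ∧ Disjoint τ σ}

/-- `K ∖ σ`, the simplices of `K` that do not contain `σ` (the empty simplex included). -/
def deletion (K : AbstractSimplicialComplex V) (σ : Finset V) : Set (Finset V) :=
  {τ | IsSimplex K τ ∧ ¬ σ ⊆ τ}

/-- The wedge `(I * Lk_K(p)) ∪ (∂I * (K ∖ p))`, where `I` is the `1`-simplex on `{p₁, p₂}`. A set
of vertices is the union of its part in `V ∖ {p}` and of its part in `{p₁, p₂}`. -/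
def wedge (K : AbstractSimplicialComplex V) (p : V) :
    AbstractSimplicialComplex (WedgeVertex V p) where
  faces := {s | s.Nonempty ∧
    (basePart p s ∈ link K {p} ∨ (s.toRight ≠ Finset.univ ∧ basePart p s ∈ deletion K {p}))}
  isRelLowerSet_faces := by
    rintro s ⟨hne, hs⟩
    refine ⟨hne, fun t hts ht => ⟨ht, ?_⟩⟩
    have hb := basePart_mono p hts
    rcases hs with ⟨h1, h2, h3⟩ | ⟨h1, h2, h3⟩
    · exact Or.inl ⟨h1.mono hb, h2.mono (Finset.union_subset_union_right hb), h3.mono_left hb⟩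
    · refine Or.inr ⟨fun h => h1 ?_, h2.mono hb, fun h => h3 (h.trans hb)⟩
      exact Finset.univ_subset_iff.mp (h ▸ Finset.toRight_subset_toRight hts)
  singleton_mem := by
    rintro (⟨u, hu⟩ | i)
    · refine ⟨Finset.singleton_nonempty _, Or.inr ⟨?_, Or.inr ?_, ?_⟩⟩
      · intro h
        have := Finset.mem_univ (0 : Fin 2)
        rw [← h] at this
        simp at this
      · convert K.singleton_mem u
        ext w
        rw [mem_basePart]
        constructor
        · rintro ⟨h, h'⟩; simpa using h'
        · intro h
          have h : w = u := by simpa using h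
          subst h
          exact ⟨hu, by simp⟩
      · rw [Finset.singleton_subset_iff, mem_basePart]
        exact fun ⟨h, _⟩ => h rfl
    · have hb : basePart p {Sum.inr i} = ∅ := by
        ext w; rw [mem_basePart]; simp
      refine ⟨Finset.singleton_nonempty _, Or.inl ?_⟩
      rw [hb]
      exact ⟨Or.inl rfl, Or.inr (by simpa using K.singleton_mem p), by simp⟩

/-- The map that sends `p` to its `i`-th copy and fixes all the other vertices. It identifies `K`
with the link in `wedge K p` of the other copy of `p`. -/
def copy (p : V) (i : Fin 2) (u : V) : WedgeVertex V p :=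
  if h : u = p then Sum.inr i else Sum.inl ⟨u, h⟩

/-- The vertex `q ≠ p` in the wedge at `p`. -/
abbrev keep {p q : V} (h : q ≠ p) : WedgeVertex V p := Sum.inl ⟨q, h⟩

/-- `wed_{p,q}(K) = wed_q(wed_p(K))`. -/
abbrev doubleWedge (K : AbstractSimplicialComplex V) {p q : V} (h : q ≠ p) :
    AbstractSimplicialComplex (WedgeVertex (WedgeVertex V p) (keep h)) :=
  wedge (wedge K p) (keep h)

/-- The edge `{p_i, q_j}` of `wed_{p,q}(K)`. -/
def copiesEdge {p q : V} (h : q ≠ p) (i j : Fin 2) :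
    Finset (WedgeVertex (WedgeVertex V p) (keep h)) :=
  {Sum.inl ⟨Sum.inr i, Sum.inr_ne_inl⟩, Sum.inr j}

/-- The map that sends `p` to `p_i`, `q` to `q_j` and fixes all the other vertices. -/
def doubleCopy {p q : V} (h : q ≠ p) (i j : Fin 2) (u : V) :
    WedgeVertex (WedgeVertex V p) (keep h) :=
  copy (keep h) j (copy p i u)

end Complexes

/-! ### Characteristic maps, DJ classes, projections -/

section CharacteristicMaps

variable {V : Type*}

/-- The matrix `(λ(v))_v` is a mod `2` characteristic map over `K` (non-singularity condition). -/
def NonSingular (K : AbstractSimplicialComplex V) {n : ℕ} (Λ : Matrix (Fin n) V (ZMod 2)) : Prop :=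
  ∀ s ∈ K.faces, s.card = n → LinearIndependent (ZMod 2) (fun v : s => Λ.col v)

/-- Mod `2` characteristic maps over `K`. -/
abbrev CharMap (K : AbstractSimplicialComplex V) (n : ℕ) : Type _ :=
  {Λ : Matrix (Fin n) V (ZMod 2) // NonSingular K Λ}

/-- DJ-equivalence: equality up to a change of basis of `ℤ₂ⁿ`. -/
def djSetoid (K : AbstractSimplicialComplex V) (n : ℕ) : Setoid (CharMap K n) where
  r Λ Λ' := ∃ g : GL (Fin n) (ZMod 2), Λ'.1 = (g : Matrix (Fin n) (Fin n) (ZMod 2)) * Λ.1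
  iseqv :=
    { refl := fun Λ => ⟨1, by simp⟩
      symm := by
        rintro Λ Λ' ⟨g, hg⟩
        refine ⟨g⁻¹, ?_⟩
        rw [hg, ← Matrix.mul_assoc, ← Units.val_mul]
        simp
      trans := by
        rintro Λ Λ' Λ'' ⟨g, hg⟩ ⟨g', hg'⟩
        exact ⟨g' * g, by rw [hg', hg, Units.val_mul, Matrix.mul_assoc]⟩ }

/-- `CM(K)`: the DJ classes of characteristic maps over the `(n-1)`-dimensional complex `K`. -/
def CM (K : AbstractSimplicialComplex V) (n : ℕ) : Type _ :=
  Quotient (djSetoid K n)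

/-- `c = Proj_σ C`, where `C` is a DJ class over `K'` and `ι` identifies the vertices of `K` with
those of the link of `σ` in `K'`: in suitable bases, `c` sends `v` to the class of `C(ι v)` in the
quotient of `ℤ₂ᴺ` by the span of the `C(w)`, `w ∈ σ`. -/
def IsProjection {V' : Type*} {K' : AbstractSimplicialComplex V'} {K : AbstractSimplicialComplex V}
    {N n : ℕ} (σ : Finset V') (ι : V → V') (C : CM K' N) (c : CM K n) : Prop :=
  ∃ (Λ : CharMap K' N) (μ : CharMap K n),
    Quotient.mk (djSetoid K' N) Λ = C ∧ Quotient.mk (djSetoid K n) μ = c ∧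
    ∃ e : ((Fin N → ZMod 2) ⧸ Submodule.span (ZMod 2) (Λ.1.col '' (σ : Set V')))
        ≃ₗ[ZMod 2] (Fin n → ZMod 2),
      ∀ v : V, μ.1.col v = e (Submodule.Quotient.mk (Λ.1.col (ι v)))

end CharacteristicMaps

/-! ### The diagram of a complex -/

section Diagram

variable {V : Type*} [DecidableEq V] {n : ℕ} (K : AbstractSimplicialComplex V)

/-- `c₁` and `c₂` are joined by an edge of colour `p` in the prediagram of `K`: they are the
projections with respect to `p₂` and `p₁` of a DJ class over `wed_p(K)`. -/
def IsEdge (p : V) (c₁ c₂ : CM K n) : Prop :=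
  ∃ C : CM (wedge K p) (n + 1),
    IsProjection {Sum.inr 1} (copy p 0) C c₁ ∧ IsProjection {Sum.inr 0} (copy p 1) C c₂

variable {p q : V} (hqp : q ≠ p)

/-- The DJ class `S` over `wed_{p,q}(K)` is the realizable square with corners `c`, `cα`
(joined to `c` by a `p`-edge), `cβ` (joined to `c` by a `q`-edge) and, opposite to `c`, `cγ`. -/
def IsRealizedBy (c cα cβ cγ : CM K n) (S : CM (doubleWedge K hqp) (n + 2)) : Prop :=
  IsProjection (copiesEdge hqp 1 1) (doubleCopy hqp 0 0) S c ∧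
  IsProjection (copiesEdge hqp 0 1) (doubleCopy hqp 1 0) S cα ∧
  IsProjection (copiesEdge hqp 1 0) (doubleCopy hqp 0 1) S cβ ∧
  IsProjection (copiesEdge hqp 0 0) (doubleCopy hqp 1 1) S cγ

/-- `c —p— cα`, `c —q— cβ` is an incomplete `pq`-square. -/
def IsIncompleteSquare (p q : V) (c cα cβ : CM K n) : Prop :=
  IsEdge K p c cα ∧ IsEdge K q c cβ

/-- `cγ` is a possible missing piece of an incomplete `pq`-square with corners `cα` and `cβ`. -/
def IsPossibleMissingPiece (p q : V) (cα cβ cγ : CM K n) : Prop :=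
  IsEdge K q cα cγ ∧ IsEdge K p cβ cγ

/-- `cγ` is the missing piece of the incomplete `pq`-square `c, cα, cβ`. -/
def IsMissingPiece (c cα cβ cγ : CM K n) : Prop :=
  IsPossibleMissingPiece K p q cα cβ cγ ∧
    ∃ S : CM (doubleWedge K hqp) (n + 2), IsRealizedBy K hqp c cα cβ cγ S

end Diagram

/-! ### Dual characteristic maps in normal form

The vertex set is now `[m] = {1, …, n} ⊔ {n+1, …, m}`, `m = n + k`, written `Fin n ⊕ Fin k`. -/

section Dual

variable {n k : ℕ}

/-- The type of the matrices of dual characteristic maps; the row of `v` is the dual colour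
of `v`. -/
abbrev DualMatrix (n k : ℕ) : Type := Matrix (Fin n ⊕ Fin k) (Fin k) (ZMod 2)

/-- The dual characteristic map in normal form of a DJ class: if `{1, …, n}` is a face, then the
class has a unique representative `(I_n | M)`, namely `A⁻¹ * Λ` for any representative `Λ`, where
`A` consists of the first `n` columns of `Λ`, and the dual is `M` on top of the identity. -/
noncomputable def dualMatrix {K : AbstractSimplicialComplex (Fin n ⊕ Fin k)} (c : CM K n) :
    DualMatrix n k :=
  Quotient.lift (s := djSetoid K n)
    (fun Λ : CharMap K n => fromRows (Λ.1.toCols₁⁻¹ * Λ.1.toCols₂) 1)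
    (by
      rintro Λ Λ' ⟨g, hg⟩
      have h1 : Λ'.1.toCols₁ = (g : Matrix (Fin n) (Fin n) (ZMod 2)) * Λ.1.toCols₁ := by
        rw [hg]; rfl
      have h2 : Λ'.1.toCols₂ = (g : Matrix (Fin n) (Fin n) (ZMod 2)) * Λ.1.toCols₂ := by
        rw [hg]; rfl
      have hdet : IsUnit (g : Matrix (Fin n) (Fin n) (ZMod 2)).det :=
        (Matrix.isUnit_iff_isUnit_det _).mp g.isUnit
      simp only [h1, h2, Matrix.mul_inv_rev, Matrix.mul_assoc]
      rw [← Matrix.mul_assoc _ (g : Matrix (Fin n) (Fin n) (ZMod 2)),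
        Matrix.nonsing_inv_mul _ hdet, Matrix.one_mul])
    c

/-- The column `λ(p)` of the normal form `(I_n | M)`, read off from the dual `L` (whose upper
block is `M`). -/
def color (L : DualMatrix n k) : Fin n ⊕ Fin k → Fin n → ZMod 2
  | Sum.inl i => Pi.single i 1
  | Sum.inr j => fun i => L (Sum.inl i) j

/-- The matrix `h = (p, λ, ψ)`: identity blocks on the diagonal, and the upper right block has
the rows `λ(p)_i ψ`. -/
def edgeMatrix (L : DualMatrix n k) (p : Fin n ⊕ Fin k) (ψ : Fin k → ZMod 2) :
    Matrix (Fin n ⊕ Fin k) (Fin n ⊕ Fin k) (ZMod 2) :=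
  fromBlocks 1 (vecMulVec (color L p) ψ) 0 1

/-- The coordinate at the vertex `p` of a row vector `ψ` indexed by `n+1, …, m`; it is `0` at the
vertices `1, …, n`. -/
def rowAt (ψ : Fin k → ZMod 2) : Fin n ⊕ Fin k → ZMod 2 :=
  Sum.elim (fun _ => 0) ψ

/-- The explicit fourth corner of the `pq`-square with corners `L`, `(p, L, φ) L`, `(q, L, ψ) L`:
it is `(q, L', ψ + ψ(p) φ) L'` with `L' = (p, L, φ) L`. -/
def fourthCorner (L : DualMatrix n k) (p q : Fin n ⊕ Fin k) (φ ψ : Fin k → ZMod 2) :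
    DualMatrix n k :=
  edgeMatrix (edgeMatrix L p φ * L) q (ψ + rowAt ψ p • φ) * (edgeMatrix L p φ * L)

/-- The finite (and computable) list of the `pq`-squares `(L, Lα, Lβ, Lγ)` with all corners in a
given finite set `D` of dual characteristic maps, with `Lα = (p, L, φ) L`, `Lβ = (q, L, ψ) L` and
`Lγ` given by the explicit formula for the fourth corner. -/
def explicitSquares (D : Finset (DualMatrix n k)) (p q : Fin n ⊕ Fin k) :
    Finset (DualMatrix n k × DualMatrix n k × DualMatrix n k × DualMatrix n k) :=
  (D ×ˢ D ×ˢ D ×ˢ D).filter fun x =>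
    ∃ φ ψ : Fin k → ZMod 2,
      x.2.1 = edgeMatrix x.1 p φ * x.1 ∧ x.2.2.1 = edgeMatrix x.1 q ψ * x.1 ∧
      x.2.2.2 = fourthCorner x.1 p q φ ψ

end Dual

end Puzzle

open Puzzle

/-!
A characteristic map over a wedge is reconstructed from its projections by linear algebra over `ℤ₂`.

*Coordinates.* A DJ class is represented by a colouring of the vertices in any `ℤ₂`-space
(`Represents`), and its projections are computed by any surjection with the right kernel
(`isProjection_iff`). A facet of `wed_p(K)` is a copy of a facet of `K` together with the other copy
of `p` (`eq_wedgeFace`), so that a colouring of a wedge or of a double wedge is non-singular if and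
only if all its projections to `K` are.

*Edges.* Two normal forms `λ`, `λ'` are joined by a `p`-edge if and only if
`λ'(v) = λ(v) + φ(v) λ(p)` with `φ(p) = 0` (`isEdge_iff`). Here `φ(p) = 0` is automatic from
`λ'(p) ≠ 0`, and `φ` is unique since `λ(p) ≠ 0`.

*Squares.* In coordinates `ℤ₂ × ℤ₂ × ℤ₂ⁿ` in which `p₂` and `q₂` are the first two basis vectors,
every class over `wed_{p,q}(K)` becomes an explicit colouring given by `λ` and two row vectors `φ`,
`ψ` (`exists_represents_squareColoring_rowAt`). Independence of the colours of `p₁`, `q₁` and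
`1, …, n` then forces `φ(q) ψ(p) = 0`, and the four projections are given by explicit formulas, the
fourth one by `fourthCorner` (`isRealizedBy_iff`). Conversely, four classes related by these
formulas are the corners of a square (`exists_isRealizedBy`).

*Missing pieces.* Given `λ`, `φ` and `ψ`, the question is whether the fourth corner is
non-singular. If `λ(p) = λ(q)`, then `φ(q) = ψ(p) = 0` and the fourth corner is
`λ + λ(p) (φ + ψ)`; it is always non-singular, because non-singularity of `λ + λ(p) χ` on a facet is
a linear condition on `χ` (`IsNonsingularColoring.shear_add`). If `λ(p) ≠ λ(q)`, these vectors are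
independent, and comparing coefficients in the two expressions of a possible missing piece shows
that it is the fourth corner (`IsPossibleMissingPiece.dualMatrix_eq`).
-/

namespace Puzzle

/-! ### Representing DJ classes by colourings in arbitrary vector spaces -/

section Represents

variable {V V' W W' U : Type*} [AddCommGroup W] [Module (ZMod 2) W] [AddCommGroup W']
  [Module (ZMod 2) W'] [AddCommGroup U] [Module (ZMod 2) U]

/-- The colouring `w` of the vertices by vectors of an arbitrary space `W` satisfies the
non-singularity condition on the faces with `n` vertices. -/
def IsNonsingularColoring (K : AbstractSimplicialComplex V) (n : ℕ) (w : V → W) : Prop :=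
  ∀ s ∈ K.faces, s.card = n → LinearIndepOn (ZMod 2) w (s : Set V)

/-- The colouring `w` of the vertices by vectors of a space `W` becomes, in a suitable basis of
`W`, a characteristic map of class `C`. Working with an arbitrary `W` makes it possible to choose
convenient coordinates, such as `W = ℤ₂ × ℤ₂ × ℤ₂ⁿ` over a double wedge. -/
def Represents {K : AbstractSimplicialComplex V} {N : ℕ} (C : CM K N) (w : V → W) : Prop :=
  ∃ Λ : CharMap K N, Quotient.mk (djSetoid K N) Λ = C ∧
    ∃ e : (Fin N → ZMod 2) ≃ₗ[ZMod 2] W, ∀ v, w v = e (Λ.1.col v)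

lemma djSetoid_rel_iff {K : AbstractSimplicialComplex V} {N : ℕ} {Λ Λ' : CharMap K N} :
    Quotient.mk (djSetoid K N) Λ = Quotient.mk (djSetoid K N) Λ' ↔
      ∃ e : (Fin N → ZMod 2) ≃ₗ[ZMod 2] (Fin N → ZMod 2), ∀ v, Λ'.1.col v = e (Λ.1.col v) := by
  rw [Quotient.eq]
  constructor
  · rintro ⟨g, hg⟩
    refine ⟨LinearMap.GeneralLinearGroup.generalLinearEquiv _ _
      (Matrix.GeneralLinearGroup.toLin g), fun v => ?_⟩
    ext i
    rw [hg]
    rfl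
  · rintro ⟨e, he⟩
    refine ⟨Matrix.GeneralLinearGroup.toLin.symm
      ((LinearMap.GeneralLinearGroup.generalLinearEquiv _ _).symm e), ?_⟩
    set g := Matrix.GeneralLinearGroup.toLin.symm
      ((LinearMap.GeneralLinearGroup.generalLinearEquiv (ZMod 2) (Fin N → ZMod 2)).symm e) with hg
    have h1 : LinearMap.GeneralLinearGroup.generalLinearEquiv _ _
        (Matrix.GeneralLinearGroup.toLin g) = e := by simp [hg]
    ext i v
    have h2 := congrFun (he v) i
    rw [← h1] at h2
    exact h2

namespace Represents

variable {K : AbstractSimplicialComplex V} {N : ℕ} {C C' : CM K N} {w : V → W} {w' : V → W'}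

lemma map (h : Represents C w) (e : W ≃ₗ[ZMod 2] W') : Represents C (e ∘ w) := by
  obtain ⟨Λ, hΛ, f, hf⟩ := h
  exact ⟨Λ, hΛ, f.trans e, fun v => by simp [hf]⟩

lemma unique (h : Represents C w) (h' : Represents C' w) : C = C' := by
  obtain ⟨Λ, rfl, f, hf⟩ := h
  obtain ⟨Λ', rfl, f', hf'⟩ := h'
  exact djSetoid_rel_iff.mpr ⟨f.trans f'.symm, fun v => by simp [← hf, hf']⟩

lemma exists_equiv (h : Represents C w) (h' : Represents C w') :
    ∃ e : W ≃ₗ[ZMod 2] W', w' = e ∘ w := by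
  obtain ⟨Λ, rfl, f, hf⟩ := h
  obtain ⟨Λ', hΛ', f', hf'⟩ := h'
  obtain ⟨g, hg⟩ := djSetoid_rel_iff.mp hΛ'
  refine ⟨(f.symm.trans g.symm).trans f', ?_⟩
  ext v
  simp [hf, hf', hg]

lemma finrank (h : Represents C w) : Module.finrank (ZMod 2) W = N := by
  obtain ⟨Λ, rfl, f, hf⟩ := h
  simpa using f.symm.finrank_eq

lemma finite (h : Represents C w) : Module.Finite (ZMod 2) W := by
  obtain ⟨Λ, rfl, f, hf⟩ := h
  exact Module.Finite.equiv f

lemma nonsingular (h : Represents C w) : IsNonsingularColoring K N w := by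
  obtain ⟨Λ, rfl, f, hf⟩ := h
  intro s hs hc
  have h1 := (Λ.2 s hs hc).map' f.toLinearMap f.ker
  have h2 : (fun v : s => w v) = f ∘ fun v : s => Λ.1.col v := by
    ext v; exact hf v
  change LinearIndependent (ZMod 2) (fun v : s => w v)
  rw [h2]
  exact h1

end Represents

lemma CM.exists_represents {K : AbstractSimplicialComplex V} {N : ℕ} (C : CM K N) :
    ∃ w : V → Fin N → ZMod 2, Represents C w := by
  induction C using Quotient.inductionOn with
  | h Λ => exact ⟨Λ.1.col, Λ, rfl, LinearEquiv.refl _ _, fun _ => rfl⟩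

lemma IsNonsingularColoring.exists_represents [Module.Finite (ZMod 2) W]
    {K : AbstractSimplicialComplex V} {N : ℕ} {w : V → W}
    (h : IsNonsingularColoring K N w) (hW : Module.finrank (ZMod 2) W = N) :
    ∃ C : CM K N, Represents C w := by
  have e : W ≃ₗ[ZMod 2] (Fin N → ZMod 2) := LinearEquiv.ofFinrankEq _ _ (by simpa using hW)
  have hΛ : NonSingular K (Matrix.of fun i v => e (w v) i) := fun s hs hc =>
    (h s hs hc).map' e.toLinearMap e.ker
  refine ⟨Quotient.mk (djSetoid K N) ⟨_, hΛ⟩, ⟨_, hΛ⟩, rfl, e.symm, fun v => ?_⟩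
  exact (e.symm_apply_apply (w v)).symm

/-- The projection of a DJ class, in terms of representing colourings: the quotient by the span of
the colours of `σ` may be replaced by any surjection with that kernel. -/
lemma isProjection_iff {K' : AbstractSimplicialComplex V'} {K : AbstractSimplicialComplex V}
    {N n : ℕ} {σ : Finset V'} {ι : V → V'} {C : CM K' N} {c : CM K n} {w : V' → W}
    (h : Represents C w) {π : W →ₗ[ZMod 2] U} (hπ : Function.Surjective π)
    (hker : LinearMap.ker π = Submodule.span (ZMod 2) (w '' σ)) :
    IsProjection σ ι C c ↔ Represents c (π ∘ w ∘ ι) := by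
  have key : ∀ (Λ : CharMap K' N) (f : (Fin N → ZMod 2) ≃ₗ[ZMod 2] W), (∀ v, w v = f (Λ.1.col v)) →
      ∃ g : ((Fin N → ZMod 2) ⧸ Submodule.span (ZMod 2) (Λ.1.col '' (σ : Set V')))
        ≃ₗ[ZMod 2] U, ∀ x, g (Submodule.Quotient.mk x) = π (f x) := by
    intro Λ f hf
    have hk : LinearMap.ker (π ∘ₗ f.toLinearMap) =
        Submodule.span (ZMod 2) (Λ.1.col '' (σ : Set V')) := by
      have hw : w '' σ = f '' (Λ.1.col '' (σ : Set V')) := by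
        rw [Set.image_image]; exact Set.image_congr fun v _ => hf v
      rw [LinearMap.ker_comp, hker, hw]
      change Submodule.comap (f : (Fin N → ZMod 2) →ₗ[ZMod 2] W) (Submodule.span _
        ((f : (Fin N → ZMod 2) →ₗ[ZMod 2] W) '' _)) = _
      rw [Submodule.span_image, Submodule.comap_map_eq_of_injective f.injective]
    have hs : Function.Surjective (π ∘ₗ f.toLinearMap) := hπ.comp f.surjective
    exact ⟨(Submodule.quotEquivOfEq _ _ hk.symm).trans (LinearMap.quotKerEquivOfSurjective _ hs),
      fun x => rfl⟩
  constructor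
  · rintro ⟨Λ, μ, hΛ, hμ, e, he⟩
    have hr : Represents C Λ.1.col := ⟨Λ, hΛ, LinearEquiv.refl _ _, fun _ => rfl⟩
    obtain ⟨f, rfl⟩ := hr.exists_equiv h
    obtain ⟨g, hg⟩ := key Λ f fun _ => rfl
    refine ⟨μ, hμ, e.symm.trans g, fun v => ?_⟩
    simp [he, hg]
  · rintro ⟨μ, hμ, e, he⟩
    obtain ⟨Λ, hΛ, f, hf⟩ := h
    obtain ⟨g, hg⟩ := key Λ f hf
    refine ⟨Λ, μ, hΛ, hμ, g.trans e.symm, fun v => ?_⟩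
    have := he v
    simp only [Function.comp_apply, hf] at this
    simp [hg, this]

/-- If `c` is the projection of `C`, then any two representing colourings are related by a
surjection whose kernel is spanned by the colours of `σ`. -/
lemma IsProjection.exists_linearMap {K' : AbstractSimplicialComplex V'}
    {K : AbstractSimplicialComplex V} {N n : ℕ} {σ : Finset V'} {ι : V → V'} {C : CM K' N}
    {c : CM K n} {w : V' → W} {u : V → U} (hp : IsProjection σ ι C c)
    (h : Represents C w) (hc : Represents c u) :
    ∃ π : W →ₗ[ZMod 2] U, Function.Surjective π ∧
      LinearMap.ker π = Submodule.span (ZMod 2) (w '' σ) ∧ ∀ v, π (w (ι v)) = u v := by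
  rw [isProjection_iff h (Submodule.mkQ_surjective _) (Submodule.ker_mkQ _)] at hp
  obtain ⟨e, rfl⟩ := hp.exists_equiv hc
  refine ⟨e.toLinearMap ∘ₗ Submodule.mkQ _, e.surjective.comp (Submodule.mkQ_surjective _), ?_,
    fun v => rfl⟩
  rw [LinearMap.ker_comp]
  simp

lemma linearIndepOn_union_image_iff {w : V' → W} {σ : Set V'} (hσ : LinearIndepOn (ZMod 2) w σ)
    {π : W →ₗ[ZMod 2] U} (hker : LinearMap.ker π = Submodule.span (ZMod 2) (w '' σ))
    {ι : V → V'} (hι : Function.Injective ι) {s : Set V} (hd : Disjoint σ (ι '' s)) :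
    LinearIndepOn (ZMod 2) w (σ ∪ ι '' s) ↔ LinearIndepOn (ZMod 2) (π ∘ w ∘ ι) s := by
  rw [← LinearIndepOn.quotient_iff_union hσ hd]
  set S := Submodule.span (ZMod 2) (w '' σ)
  have hf : LinearMap.ker (S.liftQ π hker.ge) = ⊥ := by
    rw [Submodule.ker_liftQ, hker]
    exact Submodule.mkQ_map_self S
  have h1 : π ∘ w ∘ ι = S.liftQ π hker.ge ∘ (S.mkQ ∘ w ∘ ι) := by
    ext v; simp
  have h2 : LinearIndepOn (ZMod 2) (π ∘ w ∘ ι) s ↔ LinearIndepOn (ZMod 2) (S.mkQ ∘ w ∘ ι) s := by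
    rw [h1]
    exact LinearMap.linearIndependent_iff (v := fun x : s => (S.mkQ ∘ w ∘ ι) x) _ hf
  rw [h2]
  exact ⟨fun h => h.comp_of_image hι.injOn, fun h => LinearIndepOn.image_of_comp ι _ h⟩

end Represents

/-! ### Facets of wedges and double wedges -/

section Facets

variable {V : Type*} [DecidableEq V]

lemma copy_self (p : V) (i : Fin 2) : copy p i p = Sum.inr i := by simp [copy]

lemma copy_of_ne {p u : V} (h : u ≠ p) (i : Fin 2) : copy p i u = Sum.inl ⟨u, h⟩ := by
  simp [copy, h]

lemma copy_injective (p : V) (i : Fin 2) : Function.Injective (copy p i) := by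
  intro u v h
  by_cases hu : u = p <;> by_cases hv : v = p
  · rw [hu, hv]
  · subst hu; simp [copy_self, copy_of_ne hv] at h
  · subst hv; simp [copy_self, copy_of_ne hu] at h
  · simpa [copy_of_ne hv, copy_of_ne hu] using h

lemma copy_ne_inr {p : V} {i j : Fin 2} (h : i ≠ j) (u : V) : copy p i u ≠ Sum.inr j := by
  by_cases hu : u = p
  · subst hu; simpa [copy_self] using h
  · simp [copy_of_ne hu]

lemma doubleCopy_injective {p q : V} (h : q ≠ p) (i j : Fin 2) :
    Function.Injective (doubleCopy h i j) :=
  (copy_injective (keep h) j).comp (copy_injective p i)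

lemma doubleCopy_left {p q : V} (h : q ≠ p) (i j : Fin 2) :
    doubleCopy h i j p = Sum.inl ⟨Sum.inr i, Sum.inr_ne_inl⟩ := by
  rw [doubleCopy, copy_self, copy_of_ne]

lemma doubleCopy_right {p q : V} (h : q ≠ p) (i j : Fin 2) :
    doubleCopy h i j q = Sum.inr j := by
  rw [doubleCopy, copy_of_ne h, copy_self]

lemma doubleCopy_of_ne {p q u : V} (h : q ≠ p) (i j : Fin 2) (hp : u ≠ p) (hq : u ≠ q) :
    doubleCopy h i j u = Sum.inl ⟨Sum.inl ⟨u, hp⟩, by simpa using hq⟩ := by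
  rw [doubleCopy, copy_of_ne hp, copy_of_ne]

lemma one_sub_ne (i : Fin 2) : 1 - i ≠ i := by fin_cases i <;> decide

lemma inr_notMem_image_copy (p : V) (i : Fin 2) (s : Finset V) :
    Sum.inr (1 - i) ∉ s.image (copy p i) := by
  rw [Finset.mem_image]
  rintro ⟨u, -, hu⟩
  exact copy_ne_inr (one_sub_ne i).symm u hu

/-- The simplex of `wedge K p` spanned by the `i`-th copy of `s` and by the other copy of `p`. -/
def wedgeFace (p : V) (i : Fin 2) (s : Finset V) : Finset (WedgeVertex V p) :=
  insert (Sum.inr (1 - i)) (s.image (copy p i))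

lemma card_wedgeFace (p : V) (i : Fin 2) (s : Finset V) :
    (wedgeFace p i s).card = s.card + 1 := by
  rw [wedgeFace, Finset.card_insert_of_notMem (inr_notMem_image_copy p i s),
    Finset.card_image_of_injective _ (copy_injective p i)]

lemma inl_mem_wedgeFace {p : V} {i : Fin 2} {s : Finset V} {u : {u : V // u ≠ p}} :
    Sum.inl u ∈ wedgeFace p i s ↔ u.1 ∈ s := by
  simp only [wedgeFace, Finset.mem_insert, reduceCtorEq, Finset.mem_image, false_or]
  constructor
  · rintro ⟨v, hv, h⟩
    rw [← copy_of_ne u.2 i] at h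
    rwa [← copy_injective p i h]
  · exact fun h => ⟨u, h, copy_of_ne u.2 i⟩

lemma inr_mem_wedgeFace {p : V} {i j : Fin 2} {s : Finset V} :
    Sum.inr j ∈ wedgeFace p i s ↔ j = 1 - i ∨ (j = i ∧ p ∈ s) := by
  simp only [wedgeFace, Finset.mem_insert, Sum.inr.injEq, Finset.mem_image]
  refine or_congr Iff.rfl ⟨?_, ?_⟩
  · rintro ⟨v, hv, h⟩
    by_cases hvp : v = p
    · subst hvp
      rw [copy_self] at h
      exact ⟨(Sum.inr.inj h).symm, hv⟩
    · simp [copy_of_ne hvp] at h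
  · rintro ⟨rfl, h⟩
    exact ⟨p, h, copy_self p j⟩

lemma basePart_wedgeFace (p : V) (i : Fin 2) (s : Finset V) :
    basePart p (wedgeFace p i s) = s.erase p := by
  ext u
  simp [mem_basePart, inl_mem_wedgeFace]

lemma wedgeFace_mem {K : AbstractSimplicialComplex V} (p : V) (i : Fin 2) {s : Finset V}
    (hs : s ∈ K.faces) : wedgeFace p i s ∈ (wedge K p).faces := by
  have hs' : IsSimplex K s := Or.inr hs
  refine ⟨⟨_, Finset.mem_insert_self _ _⟩, ?_⟩
  rw [basePart_wedgeFace]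
  by_cases hp : p ∈ s
  · refine Or.inl ⟨hs'.mono (Finset.erase_subset _ _), ?_, by simp⟩
    rwa [← Finset.insert_eq, Finset.insert_erase hp]
  · refine Or.inr ⟨fun h => ?_, hs'.mono (Finset.erase_subset _ _), by simp⟩
    have := Finset.mem_univ i
    rw [← h, Finset.mem_toRight, inr_mem_wedgeFace] at this
    rcases this with h | h
    · exact one_sub_ne i h.symm
    · exact hp h.2

lemma eq_wedgeFace {K : AbstractSimplicialComplex V} {n : ℕ} (hn : 0 < n)
    (hK : ∀ s ∈ K.faces, s.card ≤ n) {p : V} {t : Finset (WedgeVertex V p)}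
    (ht : t ∈ (wedge K p).faces) (hc : t.card = n + 1) :
    ∃ i, ∃ s ∈ K.faces, s.card = n ∧ t = wedgeFace p i s := by
  obtain ⟨-, ht⟩ := ht
  have hp : p ∉ basePart p t := by simp [mem_basePart]
  have hcard : (basePart p t).card + t.toRight.card = n + 1 := by
    rw [basePart, Finset.card_map, Finset.card_toLeft_add_card_toRight, hc]
  have hb : IsSimplex K (basePart p t) := by
    rcases ht with h | h
    exacts [h.1, h.2.1]
  have hbn : (basePart p t).card ≤ n := by
    rcases hb with h | h
    · simp [h]
    · exact hK _ h
  by_cases hu : t.toRight = Finset.univ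
  · have hl : IsSimplex K ({p} ∪ basePart p t) := by
      rcases ht with h | h
      exacts [h.2.1, absurd hu h.1]
    rw [← Finset.insert_eq] at hl
    refine ⟨0, insert p (basePart p t), hl.resolve_left (Finset.insert_ne_empty _ _), ?_, ?_⟩
    · rw [Finset.card_insert_of_notMem hp]
      simp [hu] at hcard
      omega
    · ext (u | j)
      · rw [inl_mem_wedgeFace, Finset.mem_insert, mem_basePart]
        simp [u.2]
      · rw [inr_mem_wedgeFace, ← Finset.mem_toRight, hu]
        fin_cases j <;> simp
  · have hr : t.toRight.card < 2 := by
      have := Finset.card_lt_univ_of_notMem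
        (Classical.not_forall.mp fun h => hu (Finset.eq_univ_iff_forall.mpr h)).choose_spec
      simpa using this
    obtain ⟨x, hx⟩ : ∃ x, t.toRight = {x} := Finset.card_eq_one.mp (by omega)
    refine ⟨1 - x, basePart p t, hb.resolve_left ?_, by omega, ?_⟩
    · intro h; simp [h] at hcard; omega
    · ext (u | j)
      · rw [inl_mem_wedgeFace, mem_basePart]
        simp [u.2]
      · rw [inr_mem_wedgeFace, ← Finset.mem_toRight, hx]
        simp [hp]

lemma card_le_of_mem_wedge {K : AbstractSimplicialComplex V} {n : ℕ}
    (hK : ∀ s ∈ K.faces, s.card ≤ n) {p : V} {t : Finset (WedgeVertex V p)}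
    (ht : t ∈ (wedge K p).faces) : t.card ≤ n + 1 := by
  obtain ⟨-, ht⟩ := ht
  have hp : p ∉ basePart p t := by simp [mem_basePart]
  have hcard : t.card = (basePart p t).card + t.toRight.card := by
    rw [basePart, Finset.card_map, Finset.card_toLeft_add_card_toRight]
  have hr : t.toRight.card ≤ 2 := by simpa using Finset.card_le_univ t.toRight
  have hS : ∀ s, IsSimplex K s → s.card ≤ n := by
    rintro s (h | h)
    · simp [h]
    · exact hK _ h
  rcases ht with h | h
  · have := hS _ h.2.1
    rw [← Finset.insert_eq, Finset.card_insert_of_notMem hp] at this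
    omega
  · have := hS _ h.2.1
    have h2 : t.toRight.card < 2 := by
      have := Finset.card_lt_univ_of_notMem
        (Classical.not_forall.mp fun h' => h.1 (Finset.eq_univ_iff_forall.mpr h')).choose_spec
      simpa using this
    omega

lemma coe_wedgeFace (p : V) (i : Fin 2) (s : Finset V) :
    (wedgeFace p i s : Set (WedgeVertex V p)) =
      (({Sum.inr (1 - i)} : Finset (WedgeVertex V p)) : Set _) ∪ copy p i '' s := by
  rw [wedgeFace, Finset.coe_insert, Finset.coe_image, Finset.coe_singleton, Set.insert_eq]

lemma coe_wedgeFace_wedgeFace {p q : V} (h : q ≠ p) (i j : Fin 2) (s : Finset V) :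
    (wedgeFace (keep h) j (wedgeFace p i s) : Set (WedgeVertex (WedgeVertex V p) (keep h))) =
      (copiesEdge h (1 - i) (1 - j) : Set (WedgeVertex (WedgeVertex V p) (keep h))) ∪
        doubleCopy h i j '' s := by
  ext x
  simp [wedgeFace, copiesEdge, doubleCopy, copy_of_ne (show Sum.inr (1 - i) ≠ keep h by simp)]
  tauto

lemma disjoint_copiesEdge {p q : V} (h : q ≠ p) (i j : Fin 2) (s : Set V) :
    Disjoint (copiesEdge h (1 - i) (1 - j) : Set (WedgeVertex (WedgeVertex V p) (keep h)))
      (doubleCopy h i j '' s) := by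
  rw [Set.disjoint_left]
  rintro x hx ⟨u, -, rfl⟩
  simp only [copiesEdge, Finset.coe_insert, Finset.coe_singleton, Set.mem_insert_iff,
    Set.mem_singleton_iff] at hx
  rcases hx with hx | hx
  · rw [← doubleCopy_left h (1 - i) j] at hx
    by_cases hu : u = p
    · subst hu
      simp [doubleCopy_left, (one_sub_ne i).symm] at hx
    · by_cases hu' : u = q
      · subst hu'; simp [doubleCopy_left, doubleCopy_right] at hx
      · simp [doubleCopy_left, doubleCopy_of_ne h _ _ hu hu'] at hx
  · exact copy_ne_inr (one_sub_ne j).symm _ hx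

variable {W U : Type*} [AddCommGroup W] [Module (ZMod 2) W] [AddCommGroup U] [Module (ZMod 2) U]

/-- A colouring of a wedge is non-singular as soon as both projections are. -/
lemma isNonsingularColoring_wedge {K : AbstractSimplicialComplex V} {n : ℕ} (hn : 0 < n)
    (hK : ∀ s ∈ K.faces, s.card ≤ n) {p : V} {w : WedgeVertex V p → W}
    (h : ∀ i, w (Sum.inr (1 - i)) ≠ 0 ∧ ∃ π : W →ₗ[ZMod 2] U,
      LinearMap.ker π = Submodule.span (ZMod 2)
        (w '' ({Sum.inr (1 - i)} : Finset (WedgeVertex V p))) ∧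
      IsNonsingularColoring K n (π ∘ w ∘ copy p i)) :
    IsNonsingularColoring (wedge K p) (n + 1) w := by
  intro t ht hc
  obtain ⟨i, s, hs, hsn, rfl⟩ := eq_wedgeFace hn hK ht hc
  obtain ⟨h0, π, hker, hπ⟩ := h i
  rw [coe_wedgeFace, linearIndepOn_union_image_iff _ hker (copy_injective p i)]
  · exact hπ s hs hsn
  · rw [Finset.coe_singleton, Set.disjoint_singleton_left, Set.mem_image]
    rintro ⟨u, -, hu⟩
    exact copy_ne_inr (one_sub_ne i).symm u hu
  · simpa using h0

/-- A colouring of a double wedge is non-singular as soon as its four corners are. -/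
lemma isNonsingularColoring_doubleWedge {K : AbstractSimplicialComplex V} {n : ℕ} (hn : 0 < n)
    (hK : ∀ s ∈ K.faces, s.card ≤ n) {p q : V} (hqp : q ≠ p)
    {w : WedgeVertex (WedgeVertex V p) (keep hqp) → W}
    (h : ∀ i j, LinearIndepOn (ZMod 2) w (copiesEdge hqp (1 - i) (1 - j) : Set _) ∧
      ∃ π : W →ₗ[ZMod 2] U,
      LinearMap.ker π = Submodule.span (ZMod 2)
        (w '' (copiesEdge hqp (1 - i) (1 - j) : Set _)) ∧
      IsNonsingularColoring K n (π ∘ w ∘ doubleCopy hqp i j)) :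
    IsNonsingularColoring (doubleWedge K hqp) (n + 2) w := by
  intro t ht hc
  obtain ⟨j, t', ht', hc', rfl⟩ := eq_wedgeFace (Nat.succ_pos n)
    (fun s hs => card_le_of_mem_wedge hK hs) ht hc
  obtain ⟨i, s, hs, hsn, rfl⟩ := eq_wedgeFace hn hK ht' hc'
  obtain ⟨h0, π, hker, hπ⟩ := h i j
  rw [coe_wedgeFace_wedgeFace, linearIndepOn_union_image_iff h0 hker
    (doubleCopy_injective hqp i j) (disjoint_copiesEdge hqp i j _)]
  exact hπ s hs hsn

/-- The colours over the union of an edge `{p_{1-i}, q_{1-j}}` and the corresponding copy of a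
facet of `K` are linearly independent. -/
lemma IsNonsingularColoring.linearIndepOn_doubleWedge {K : AbstractSimplicialComplex V} {n : ℕ}
    {p q : V} {hqp : q ≠ p} {w : WedgeVertex (WedgeVertex V p) (keep hqp) → W}
    (h : IsNonsingularColoring (doubleWedge K hqp) (n + 2) w) (i j : Fin 2) {s : Finset V}
    (hs : s ∈ K.faces) (hsn : s.card = n) :
    LinearIndepOn (ZMod 2) w
      ((copiesEdge hqp (1 - i) (1 - j) : Set (WedgeVertex (WedgeVertex V p) (keep hqp))) ∪
        doubleCopy hqp i j '' s) := by
  rw [← coe_wedgeFace_wedgeFace]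
  exact h _ (wedgeFace_mem _ j (wedgeFace_mem p i hs)) (by rw [card_wedgeFace, card_wedgeFace, hsn])

end Facets

/-! ### Non-singularity in terms of linear functionals -/

section Functionals

variable {V W : Type*} [AddCommGroup W] [Module (ZMod 2) W]

lemma eq_zero_or_eq_one (x : ZMod 2) : x = 0 ∨ x = 1 := by
  revert x; decide

lemma exists_functional_of_linearIndepOn {w : V → W} {t : Set V}
    (h : LinearIndepOn (ZMod 2) w t) (a : V → ZMod 2) :
    ∃ f : W →ₗ[ZMod 2] ZMod 2, ∀ v ∈ t, f (w v) = a v := by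
  have h' : LinearIndependent (ZMod 2) (fun v : t => w v) := h
  obtain ⟨f, hf⟩ := LinearMap.exists_extend ((Module.Basis.span h').constr (ZMod 2) fun v => a v)
  refine ⟨f, fun v hv => ?_⟩
  have h1 := (Module.Basis.span h').constr_basis (ZMod 2) (fun v => a v) ⟨v, hv⟩
  rw [← hf] at h1
  simpa [Module.Basis.span_apply] using h1

lemma linearIndepOn_iff_functional [Module.Finite (ZMod 2) W] {w : V → W} {t : Finset V}
    (ht : t.card = Module.finrank (ZMod 2) W) :
    LinearIndepOn (ZMod 2) w (t : Set V) ↔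
      ∀ f : W →ₗ[ZMod 2] ZMod 2, (∀ v ∈ t, f (w v) = 0) → f = 0 := by
  have hr : Set.range (fun v : t => w v) = w '' t := by ext; simp
  have hc : Fintype.card t = Module.finrank (ZMod 2) W := by simpa using ht
  constructor
  · intro h f hf
    have h' : LinearIndependent (ZMod 2) (fun v : t => w v) := h
    have hspan := h'.span_eq_top_of_card_eq_finrank' hc
    rw [hr] at hspan
    refine LinearMap.ext_on hspan ?_
    rintro _ ⟨v, hv, rfl⟩
    simpa using hf v hv
  · intro h
    change LinearIndependent (ZMod 2) (fun v : t => w v)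
    refine linearIndependent_of_top_le_span_of_card_eq_finrank ?_ hc
    rw [hr]
    by_contra hlt
    obtain ⟨f, hf, hle⟩ := Submodule.exists_le_ker_of_lt_top _ (lt_top_iff_ne_top.mpr
      fun h' => hlt h'.ge)
    exact hf (h f fun v hv => hle (Submodule.subset_span ⟨v, hv, rfl⟩))

lemma Represents.functional_eq_zero {K : AbstractSimplicialComplex V} {N : ℕ} {C : CM K N}
    {w : V → W} (h : Represents C w) {t : Finset V} (ht : t ∈ K.faces) (hc : t.card = N)
    (f : W →ₗ[ZMod 2] ZMod 2) (hf : ∀ v ∈ t, f (w v) = 0) : f = 0 := by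
  have := h.finite
  exact (linearIndepOn_iff_functional (hc.trans h.finrank.symm)).mp (h.nonsingular t ht hc) f hf

lemma IsNonsingularColoring.ne_zero {K : AbstractSimplicialComplex V} {n : ℕ} {w : V → W}
    (h : IsNonsingularColoring K n w) (hK : IsPure K n) (v : V) : w v ≠ 0 := by
  obtain ⟨-, t, ht, hvt, hc⟩ := hK {v} (K.singleton_mem v)
  exact (h t ht hc).ne_zero (by simpa using hvt)

/-- The colouring obtained from `l` by adding the multiple `a(v) l(p)` to each colour `l(v)`. -/
def shear (l : V → W) (p : V) (a : V → ZMod 2) : V → W := fun v => l v + a v • l p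

/-- If `t` is a facet with independent colours, then `shear l p a` stays independent on `t` if and
only if the functional `f_a` with values `a` on the basis `l(t)` vanishes at `l(p)`. This condition
is additive in `a`. -/
lemma IsNonsingularColoring.shear_add {K : AbstractSimplicialComplex V} {n : ℕ}
    [Module.Finite (ZMod 2) W] (hW : Module.finrank (ZMod 2) W = n) {l : V → W} {p : V}
    {a b : V → ZMod 2} (hl : IsNonsingularColoring K n l)
    (ha : IsNonsingularColoring K n (shear l p a)) (hb : IsNonsingularColoring K n (shear l p b)) :
    IsNonsingularColoring K n (shear l p (a + b)) := by
  intro t ht hc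
  have hc' := hc.trans hW.symm
  have hl' := hl t ht hc
  have key : ∀ a : V → ZMod 2, IsNonsingularColoring K n (shear l p a) →
      ∃ f : W →ₗ[ZMod 2] ZMod 2, (∀ v ∈ t, f (l v) = a v) ∧ f (l p) = 0 := by
    intro a ha
    obtain ⟨f, hf⟩ := exists_functional_of_linearIndepOn hl' a
    refine ⟨f, hf, ?_⟩
    by_contra h0
    have h1 := (eq_zero_or_eq_one (f (l p))).resolve_left h0
    have hf0 := (linearIndepOn_iff_functional hc').mp (ha t ht hc) f fun v hv => ?_
    · exact h0 (by rw [hf0]; rfl)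
    rw [shear, map_add, map_smul, h1, hf v hv, smul_eq_mul, mul_one, CharTwo.add_self_eq_zero]
  obtain ⟨f, hf, hfp⟩ := key a ha
  obtain ⟨g, hg, hgp⟩ := key b hb
  rw [linearIndepOn_iff_functional hc'] at hl' ⊢
  intro h hh
  simp only [shear, map_add, map_smul, Pi.add_apply, smul_eq_mul] at hh
  have hp : h (l p) = 0 := by
    by_contra h0
    have h1 := (eq_zero_or_eq_one (h (l p))).resolve_left h0
    have h2 := hl' (h + (f + g)) fun v hv => by
      have := hh v hv
      rw [h1, mul_one] at this
      simpa [hf v hv, hg v hv] using this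
    have h3 := LinearMap.congr_fun h2 (l p)
    simp [hfp, hgp, h1] at h3
  refine hl' h fun v hv => ?_
  simpa [hp] using hh v hv

end Functionals

/-! ### Normal forms -/

section NormalForm

variable {n k : ℕ} {K : AbstractSimplicialComplex (Fin n ⊕ Fin k)}

/-- The lower block of `L` is the identity matrix, so that `L` is the dual of the matrix
`(I_n | M)`, where `M` is the upper block of `L`. -/
def IsNormal (L : DualMatrix n k) : Prop := ∃ M, L = fromRows M 1

lemma isNormal_dualMatrix (c : CM K n) : IsNormal (dualMatrix c) := by
  induction c using Quotient.inductionOn with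
  | h Λ => exact ⟨_, rfl⟩

lemma IsNormal.ext {L L' : DualMatrix n k} (h : IsNormal L) (h' : IsNormal L')
    (hc : color L = color L') : L = L' := by
  obtain ⟨M, rfl⟩ := h
  obtain ⟨M', rfl⟩ := h'
  congr 1
  ext i j
  exact congrFun (congrFun hc (Sum.inr j)) i

lemma edgeMatrix_mul_fromRows (L : DualMatrix n k) (p : Fin n ⊕ Fin k) (φ : Fin k → ZMod 2)
    (M : Matrix (Fin n) (Fin k) (ZMod 2)) :
    edgeMatrix L p φ * fromRows M (1 : Matrix (Fin k) (Fin k) (ZMod 2)) =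
      fromRows (M + vecMulVec (color L p) φ) (1 : Matrix (Fin k) (Fin k) (ZMod 2)) := by
  rw [edgeMatrix, fromBlocks_mul_fromRows]
  simp

lemma IsNormal.edgeMatrix_mul {L : DualMatrix n k} (h : IsNormal L) (L' : DualMatrix n k)
    (p : Fin n ⊕ Fin k) (φ : Fin k → ZMod 2) : IsNormal (edgeMatrix L' p φ * L) := by
  obtain ⟨M, rfl⟩ := h
  exact ⟨_, edgeMatrix_mul_fromRows L' p φ M⟩

/-- Left multiplication of the dual by `(p, λ', φ)` adds `φ(v) λ'(p)` to the colour of `v`. -/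
lemma IsNormal.color_edgeMatrix_mul' {L : DualMatrix n k} (h : IsNormal L) (L' : DualMatrix n k)
    (p : Fin n ⊕ Fin k) (φ : Fin k → ZMod 2) (v : Fin n ⊕ Fin k) :
    color (edgeMatrix L' p φ * L) v = color L v + rowAt φ v • color L' p := by
  obtain ⟨M, rfl⟩ := h
  rw [edgeMatrix_mul_fromRows]
  rcases v with i | j
  · simp [color, rowAt]
  · ext i
    simp [color, rowAt, vecMulVec_apply, mul_comm]

lemma IsNormal.color_edgeMatrix_mul {L : DualMatrix n k} (h : IsNormal L)
    (p : Fin n ⊕ Fin k) (φ : Fin k → ZMod 2) :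
    color (edgeMatrix L p φ * L) = shear (color L) p (rowAt φ) :=
  funext (h.color_edgeMatrix_mul' L p φ)

lemma rowAt_add_smul (φ ψ : Fin k → ZMod 2) (x : ZMod 2) :
    (rowAt (ψ + x • φ) : Fin n ⊕ Fin k → ZMod 2) = rowAt ψ + x • rowAt φ := by
  ext (i | j) <;> simp [rowAt]

lemma IsNormal.fourthCorner {L : DualMatrix n k} (h : IsNormal L) (p q : Fin n ⊕ Fin k)
    (φ ψ : Fin k → ZMod 2) : IsNormal (fourthCorner L p q φ ψ) :=
  (h.edgeMatrix_mul L p φ).edgeMatrix_mul _ _ _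

lemma IsNormal.color_fourthCorner {L : DualMatrix n k} (h : IsNormal L) (p q : Fin n ⊕ Fin k)
    (φ ψ : Fin k → ZMod 2) : color (Puzzle.fourthCorner L p q φ ψ) =
      shear (shear (color L) p (rowAt φ)) q (rowAt ψ + rowAt ψ p • rowAt φ) := by
  rw [Puzzle.fourthCorner, (h.edgeMatrix_mul L p φ).color_edgeMatrix_mul, h.color_edgeMatrix_mul,
    rowAt_add_smul]

lemma represents_color_dualMatrix (hF : Finset.univ.map Function.Embedding.inl ∈ K.faces)
    (c : CM K n) : Represents c (color (dualMatrix c)) := by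
  induction c using Quotient.inductionOn with
  | h Λ =>
    have hli : LinearIndependent (ZMod 2) Λ.1.toCols₁.col :=
      (Λ.2 _ hF (by simp)).comp
        (fun i : Fin n => ⟨Sum.inl i, Finset.mem_map_of_mem _ (Finset.mem_univ i)⟩)
        (fun i j h => Sum.inl_injective (congrArg Subtype.val h))
    have hdet := (Matrix.isUnit_iff_isUnit_det _).mp
      (Matrix.linearIndependent_cols_iff_isUnit.mp hli)
    have h1 := Matrix.mul_nonsing_inv _ hdet
    have h2 := Matrix.nonsing_inv_mul _ hdet
    refine ⟨Λ, rfl, Matrix.toLin'OfInv h1 h2, fun v => ?_⟩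
    change _ = Λ.1.toCols₁⁻¹ *ᵥ Λ.1.col v
    rcases v with i | j
    · change Pi.single i 1 = Λ.1.toCols₁⁻¹ *ᵥ Λ.1.toCols₁.col i
      ext i'
      have := congrFun (congrFun h2 i') i
      rw [Matrix.mul_apply] at this
      change _ = ∑ x, Λ.1.toCols₁⁻¹ i' x * Λ.1.toCols₁ x i
      rw [this, Matrix.one_apply, Pi.single_apply]
    · ext i'
      rfl

lemma linearMap_ext_of_color {U : Type*} [AddCommGroup U] [Module (ZMod 2) U]
    {L L' : DualMatrix n k} {f g : (Fin n → ZMod 2) →ₗ[ZMod 2] U}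
    (h : ∀ i, f (color L (Sum.inl i)) = g (color L' (Sum.inl i))) : f = g := by
  refine LinearMap.pi_ext' fun i => LinearMap.ext_ring ?_
  exact h i

/-- The normal form is unique. -/
lemma Represents.dualMatrix_eq (hF : Finset.univ.map Function.Embedding.inl ∈ K.faces)
    {c : CM K n} {L : DualMatrix n k} (h : Represents c (color L)) (hL : IsNormal L) :
    dualMatrix c = L := by
  obtain ⟨e, he⟩ := (represents_color_dualMatrix hF c).exists_equiv h
  have h1 : e.toLinearMap = LinearMap.id :=
    linearMap_ext_of_color (L := dualMatrix c) (L' := L) fun i => (congrFun he (Sum.inl i)).symm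
  refine (isNormal_dualMatrix c).ext hL ?_
  rw [he]
  ext1 v
  exact (LinearMap.congr_fun h1 _).symm

lemma dualMatrix_eq_iff (hF : Finset.univ.map Function.Embedding.inl ∈ K.faces)
    {c : CM K n} {L : DualMatrix n k} (hL : IsNormal L) :
    dualMatrix c = L ↔ Represents c (color L) :=
  ⟨fun h => h ▸ represents_color_dualMatrix hF c, fun h => h.dualMatrix_eq hF hL⟩

lemma dualMatrix_injective (hF : Finset.univ.map Function.Embedding.inl ∈ K.faces) :
    Function.Injective (dualMatrix (K := K)) := fun c c' h =>
  (represents_color_dualMatrix hF c).unique (h ▸ represents_color_dualMatrix hF c')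

lemma exists_dualMatrix_eq (hF : Finset.univ.map Function.Embedding.inl ∈ K.faces)
    {L : DualMatrix n k} (hL : IsNormal L) (h : IsNonsingularColoring K n (color L)) :
    ∃ c : CM K n, dualMatrix c = L := by
  obtain ⟨c, hc⟩ := h.exists_represents (by simp)
  exact ⟨c, hc.dualMatrix_eq hF hL⟩

lemma isNonsingularColoring_color (hF : Finset.univ.map Function.Embedding.inl ∈ K.faces)
    (c : CM K n) : IsNonsingularColoring K n (color (dualMatrix c)) :=
  (represents_color_dualMatrix hF c).nonsingular

lemma color_dualMatrix_ne_zero (hK : IsPure K n)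
    (hF : Finset.univ.map Function.Embedding.inl ∈ K.faces) (c : CM K n) (v : Fin n ⊕ Fin k) :
    color (dualMatrix c) v ≠ 0 :=
  (isNonsingularColoring_color hF c).ne_zero hK v

end NormalForm

/-! ### Edges of the diagram -/

section Edges

/-- The colouring of `wed_p(K)` by `ℤ₂ × U` whose projections at `p₂` and `p₁` are `l` and, if
`a(p) = 0`, `shear l p a`. -/
def edgeColoring {V U : Type*} [AddCommGroup U] (l : V → U) (p : V) (a : V → ZMod 2) :
    WedgeVertex V p → ZMod 2 × U :=
  Sum.elim (fun u => (a u, l u)) (fun i => if i = 0 then (1, l p) else (1, 0))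

lemma isEdge_of_represents_shear {V U : Type*} [DecidableEq V] [AddCommGroup U]
    [Module (ZMod 2) U] [Module.Finite (ZMod 2) U] {K : AbstractSimplicialComplex V} {n : ℕ}
    (hn : 0 < n) (hK : ∀ s ∈ K.faces, s.card ≤ n) (hU : Module.finrank (ZMod 2) U = n)
    {l : V → U} {p : V} {a : V → ZMod 2} (hap : a p = 0) {c c' : CM K n}
    (hc : Represents c l) (hc' : Represents c' (shear l p a)) : IsEdge K p c c' := by
  have h0 : ((LinearMap.snd (ZMod 2) (ZMod 2) U : _ →ₗ[ZMod 2] U) ∘ edgeColoring l p a ∘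
      copy p 0) = l := by
    ext1 v
    by_cases hv : v = p
    · subst hv; simp [copy_self, edgeColoring]
    · simp [copy_of_ne hv, edgeColoring]
  have h1 : (((LinearMap.fst (ZMod 2) (ZMod 2) U).smulRight (l p) +
      LinearMap.snd (ZMod 2) (ZMod 2) U : _ →ₗ[ZMod 2] U) ∘ edgeColoring l p a ∘
      copy p 1) = shear l p a := by
    ext1 v
    by_cases hv : v = p
    · subst hv; simp [copy_self, edgeColoring, shear, hap]
    · simp [copy_of_ne hv, edgeColoring, shear, add_comm]
  have k0 : LinearMap.ker (LinearMap.snd (ZMod 2) (ZMod 2) U) = Submodule.span (ZMod 2)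
      (edgeColoring l p a '' (({Sum.inr 1} : Finset (WedgeVertex V p)) : Set _)) := by
    ext ⟨x, z⟩
    simp [edgeColoring, Submodule.mem_span_singleton, eq_comm]
  have k1 : LinearMap.ker ((LinearMap.fst (ZMod 2) (ZMod 2) U).smulRight (l p) +
      LinearMap.snd (ZMod 2) (ZMod 2) U) = Submodule.span (ZMod 2)
      (edgeColoring l p a '' (({Sum.inr 0} : Finset (WedgeVertex V p)) : Set _)) := by
    ext ⟨x, z⟩
    simp [edgeColoring, Submodule.mem_span_singleton, ← ZModModule.sub_eq_add, sub_eq_zero]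
  have hw : IsNonsingularColoring (wedge K p) (n + 1) (edgeColoring l p a) := by
    refine isNonsingularColoring_wedge (U := U) hn hK fun i => ?_
    fin_cases i
    · exact ⟨by simp [edgeColoring], _, k0, by rw [Fin.zero_eta, h0]; exact hc.nonsingular⟩
    · exact ⟨by simp [edgeColoring], _, k1, by rw [Fin.mk_one, h1]; exact hc'.nonsingular⟩
  obtain ⟨C, hC⟩ := hw.exists_represents (by
    rw [Module.finrank_prod, hU, Module.finrank_self, add_comm])
  refine ⟨C, (isProjection_iff hC ?_ k0).mpr (by rwa [h0]),
    (isProjection_iff hC ?_ k1).mpr (by rwa [h1])⟩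
  · exact LinearMap.snd_surjective
  · exact fun z => ⟨(0, z), by simp⟩

variable {n k : ℕ} {K : AbstractSimplicialComplex (Fin n ⊕ Fin k)}

lemma pos_of_univ_mem_faces (hF : Finset.univ.map Function.Embedding.inl ∈ K.faces) : 0 < n := by
  have := (K.isRelLowerSet_faces hF).1
  obtain ⟨x, hx⟩ := this
  obtain ⟨i, -, -⟩ := Finset.mem_map.mp hx
  exact i.pos

/-- Two classes are joined by a `p`-edge if and only if the normal forms satisfy
`λ'(v) = λ(v) + φ(v) λ(p)` with `φ(p) = 0`. For the forward direction, both normal forms induce the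
same map to the quotient by `λ'(p)`, because they agree there on the standard basis. -/
lemma isEdge_iff (hK : IsPure K n) (hF : Finset.univ.map Function.Embedding.inl ∈ K.faces)
    {p : Fin n ⊕ Fin k} {c c' : CM K n} : IsEdge K p c c' ↔
      ∃ φ : Fin k → ZMod 2, (rowAt φ p : ZMod 2) = 0 ∧
        dualMatrix c' = edgeMatrix (dualMatrix c) p φ * dualMatrix c := by
  have hc := represents_color_dualMatrix hF c
  have hc' := represents_color_dualMatrix hF c'
  constructor
  · rintro ⟨C, h0, h1⟩
    obtain ⟨w, hw⟩ := CM.exists_represents C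
    obtain ⟨π, hπ, hker, hl⟩ := h0.exists_linearMap hw hc
    obtain ⟨π', hπ', hker', hl'⟩ := h1.exists_linearMap hw hc'
    set l := color (dualMatrix c)
    set l' := color (dualMatrix c')
    let T := Submodule.span (ZMod 2) {l' p}
    have hT : l' p ∈ T := Submodule.mem_span_singleton_self _
    have hp2 : π' (w (Sum.inr 1)) = l' p := by rw [← hl', copy_self]
    have hle : LinearMap.ker π ≤ LinearMap.ker (T.mkQ ∘ₗ π') := by
      rw [hker, Submodule.span_le]
      rintro _ ⟨v, hv, rfl⟩
      obtain rfl : v = Sum.inr 1 := by simpa using hv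
      simpa [hp2] using hT
    obtain ⟨r, hr⟩ : ∃ r : (Fin n → ZMod 2) →ₗ[ZMod 2] ((Fin n → ZMod 2) ⧸ T),
        r ∘ₗ π = T.mkQ ∘ₗ π' := by
      refine ⟨(LinearMap.ker π).liftQ _ hle ∘ₗ (π.quotKerEquivOfSurjective hπ).symm.toLinearMap, ?_⟩
      refine LinearMap.ext fun x => ?_
      have : (π.quotKerEquivOfSurjective hπ).symm (π x) = Submodule.Quotient.mk x := by
        rw [LinearEquiv.symm_apply_eq]; rfl
      simp [this]
    have hp1 : π' (w (Sum.inr 0)) = 0 := by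
      rw [← LinearMap.mem_ker, hker']
      exact Submodule.subset_span ⟨_, by simp, rfl⟩
    have hrl : ∀ v, r (l v) = T.mkQ (l' v) := by
      intro v
      have h2 := LinearMap.congr_fun hr (w (copy p 0 v))
      simp only [LinearMap.comp_apply, hl] at h2
      rw [h2]
      by_cases hv : v = p
      · subst hv
        rw [copy_self, hp1, map_zero]
        exact ((Submodule.Quotient.mk_eq_zero T).mpr hT).symm
      · rw [copy_of_ne hv 0, ← copy_of_ne hv 1, hl']
    have hrm : r = T.mkQ := linearMap_ext_of_color fun i => hrl (Sum.inl i)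
    have hmem : ∀ v, ∃ a : ZMod 2, a • l' p = l v - l' v := by
      intro v
      rw [← Submodule.mem_span_singleton]
      have h2 := hrl v
      rw [hrm] at h2
      exact (Submodule.Quotient.eq T).mp h2
    have hpp : l' p = l p := by
      obtain ⟨a, ha⟩ := hmem p
      rcases eq_zero_or_eq_one a with rfl | rfl
      · rw [zero_smul] at ha
        exact (sub_eq_zero.mp ha.symm).symm
      · rw [one_smul, ZModModule.sub_eq_add, right_eq_add] at ha
        exact absurd ha (color_dualMatrix_ne_zero hK hF c p)
    choose a ha using hmem
    let φ : Fin k → ZMod 2 := fun j => if Sum.inr j = p then 0 else a (Sum.inr j)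
    have hφ : (rowAt φ p : ZMod 2) = 0 := by
      rcases p with i | j <;> simp [rowAt, φ]
    refine ⟨φ, hφ, (isNormal_dualMatrix c').ext ((isNormal_dualMatrix c).edgeMatrix_mul _ _ _) ?_⟩
    rw [(isNormal_dualMatrix c).color_edgeMatrix_mul]
    ext1 v
    by_cases hv : v = p
    · rw [shear, hv, hφ, zero_smul, add_zero]
      exact hpp
    · rcases v with i | j
      · simp [shear, rowAt, color]
      · have h3 := ha (Sum.inr j)
        change l' (Sum.inr j) = l (Sum.inr j) + φ j • l p
        rw [← hpp, show φ j = a (Sum.inr j) by simp [φ, hv], h3, ZModModule.sub_eq_add,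
          ← add_assoc, ZModModule.add_self, zero_add]
  · rintro ⟨φ, hφ, h⟩
    rw [h, (isNormal_dualMatrix c).color_edgeMatrix_mul] at hc'
    exact isEdge_of_represents_shear (pos_of_univ_mem_faces hF) (fun s hs => (hK s hs).1)
      (by simp) hφ hc hc'

end Edges

/-! ### Colourings of double wedges -/

section Coloring

variable {V U : Type*} [AddCommGroup U] [Module (ZMod 2) U]

/-- The colouring of `wed_{p,q}(K)` by `ℤ₂ × ℤ₂ × U` with `p₂ ↦ (1, 0, 0)`, `q₂ ↦ (0, 1, 0)`,
`p₁ ↦ (1, b(p), l(p))`, `q₁ ↦ (a(q), 1, l(q))` and `u ↦ (a(u), b(u), l(u))` for all the other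
vertices. -/
def squareColoring {p q : V} (h : q ≠ p) (l : V → U) (a b : V → ZMod 2) :
    WedgeVertex (WedgeVertex V p) (keep h) → ZMod 2 × ZMod 2 × U :=
  Sum.elim
    (fun u => Sum.elim (fun v => (a v.1, b v.1, l v.1))
      (fun i => if i = 0 then (1, b p, l p) else (1, 0, 0)) u.1)
    (fun j => if j = 0 then (a q, 1, l q) else (0, 1, 0))

/-- The corners of the square `squareColoring h l a b`. The first index is `0` on the side of `l`
and `1` on the opposite side in the direction `p`; the second one does the same for `q`. -/
def squareCorner (l : V → U) (p q : V) (a b : V → ZMod 2) (i j : Fin 2) : V → U :=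
  if i = 0 then if j = 0 then l else shear l q b
  else if j = 0 then shear l p a else shear (shear l p a) q (b + b p • a)

/-- The projection of `ℤ₂ × ℤ₂ × U` to `U` that kills `(1, 0, P)` and `(0, 1, Q)`. -/
def cornerMap (P Q : U) : ZMod 2 × ZMod 2 × U →ₗ[ZMod 2] U :=
  (LinearMap.fst (ZMod 2) (ZMod 2) (ZMod 2 × U)).smulRight P +
    ((LinearMap.fst (ZMod 2) (ZMod 2) U).smulRight Q + LinearMap.snd (ZMod 2) (ZMod 2) U) ∘ₗ
      LinearMap.snd (ZMod 2) (ZMod 2) (ZMod 2 × U)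

lemma cornerMap_apply (P Q : U) (x y : ZMod 2) (z : U) :
    cornerMap P Q (x, y, z) = x • P + (y • Q + z) := rfl

lemma cornerMap_surjective (P Q : U) : Function.Surjective (cornerMap P Q) := fun z =>
  ⟨(0, 0, z), by simp [cornerMap_apply]⟩

lemma mem_ker_cornerMap {P Q : U} {e : ZMod 2 × ZMod 2 × U} :
    e ∈ LinearMap.ker (cornerMap P Q) ↔ e.2.2 = e.1 • P + e.2.1 • Q := by
  obtain ⟨x, y, z⟩ := e
  rw [LinearMap.mem_ker, cornerMap_apply, ← add_assoc, ← ZModModule.sub_eq_add, sub_eq_zero,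
    eq_comm]

/-- Two vectors of the kernel of `cornerMap P Q` span it if the determinant of their first two
coordinates is not zero. -/
lemma ker_cornerMap {P Q : U} {e f : ZMod 2 × ZMod 2 × U}
    (he : e ∈ LinearMap.ker (cornerMap P Q)) (hf : f ∈ LinearMap.ker (cornerMap P Q))
    (hdet : e.1 * f.2.1 + e.2.1 * f.1 = 1) :
    LinearMap.ker (cornerMap P Q) = Submodule.span (ZMod 2) {e, f} := by
  refine le_antisymm ?_ (Submodule.span_le.mpr (by rintro _ (rfl | rfl) <;> assumption))
  rintro ⟨x, y, z⟩ h
  obtain ⟨e1, e2, e3⟩ := e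
  obtain ⟨f1, f2, f3⟩ := f
  rw [mem_ker_cornerMap] at he hf h
  simp only at he hf h hdet
  subst he hf h
  -- Cramer's rule
  refine Submodule.mem_span_pair.mpr ⟨x * f2 + y * f1, e1 * y + e2 * x, ?_⟩
  have h1 : (x * f2 + y * f1) * e1 + (e1 * y + e2 * x) * f1 = x := by
    revert x y e1 e2 f1 f2; decide
  have h2 : (x * f2 + y * f1) * e2 + (e1 * y + e2 * x) * f2 = y := by
    revert x y e1 e2 f1 f2; decide
  ext1
  · simpa using h1
  ext1
  · simpa using h2
  · simp only [Prod.smul_mk, Prod.mk_add_mk, smul_add, smul_smul]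
    trans ((x * f2 + y * f1) * e1 + (e1 * y + e2 * x) * f1) • P +
      ((x * f2 + y * f1) * e2 + (e1 * y + e2 * x) * f2) • Q
    · module
    · rw [h1, h2]

variable [DecidableEq V] {p q : V} {h : q ≠ p} {l : V → U} {a b : V → ZMod 2}

lemma linearIndepOn_pair_of_det {V' : Type*} {w : V' → ZMod 2 × ZMod 2 × U} {x y : V'} (hxy : x ≠ y)
    (hdet : (w x).1 * (w y).2.1 + (w x).2.1 * (w y).1 = 1) :
    LinearIndepOn (ZMod 2) w {x, y} := by
  have h0 : w x ≠ 0 := by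
    intro h
    simp [h] at hdet
  rw [linearIndepOn_pair_iff w hxy h0]
  intro c hc
  rw [← hc] at hdet
  clear hc
  simp only [Prod.smul_fst, Prod.smul_snd, smul_eq_mul] at hdet
  generalize (w x).1 = s at hdet
  generalize (w x).2.1 = t at hdet
  revert c s t; decide

/-- The projections of `squareColoring h l a b` are its corners. The condition `a(q) b(p) = 0` says
that the first two coordinates of the colours of `p₁` and `q₁` are independent. -/
lemma squareColoring_projection (ha : a p = 0) (hb : b q = 0) (hab : a q * b p = 0) (i j : Fin 2) :
    LinearIndepOn (ZMod 2) (squareColoring h l a b) (copiesEdge h (1 - i) (1 - j) : Set _) ∧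
      ∃ π : ZMod 2 × ZMod 2 × U →ₗ[ZMod 2] U, Function.Surjective π ∧
      LinearMap.ker π = Submodule.span (ZMod 2)
        (squareColoring h l a b '' (copiesEdge h (1 - i) (1 - j) : Set _)) ∧
      π ∘ squareColoring h l a b ∘ doubleCopy h i j = squareCorner l p q a b i j := by
  set w := squareColoring h l a b
  let P : U := if i = 0 then 0 else if j = 0 then l p else l p + b p • (l q + a q • l p)
  let Q : U := if j = 0 then 0 else if i = 0 then l q else l q + a q • l p
  let x : WedgeVertex (WedgeVertex V p) (keep h) := Sum.inl ⟨Sum.inr (1 - i), Sum.inr_ne_inl⟩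
  let y : WedgeVertex (WedgeVertex V p) (keep h) := Sum.inr (1 - j)
  have hxy : (copiesEdge h (1 - i) (1 - j) : Set (WedgeVertex (WedgeVertex V p) (keep h))) =
      {x, y} := by simp [copiesEdge, x, y]
  have hx : w x = if i = 0 then (1, 0, 0) else (1, b p, l p) := by
    fin_cases i <;> simp [w, squareColoring, x]
  have hy : w y = if j = 0 then (0, 1, 0) else (a q, 1, l q) := by
    fin_cases j <;> simp [w, squareColoring, y]
  have hdet : (w x).1 * (w y).2.1 + (w x).2.1 * (w y).1 = 1 := by
    rw [hx, hy]
    fin_cases i <;> fin_cases j <;> simp [mul_comm (b p), hab]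
  have hxk : w x ∈ LinearMap.ker (cornerMap P Q) := by
    rw [mem_ker_cornerMap, hx]
    fin_cases i <;> fin_cases j <;> simp [P, Q, ZModModule.add_self, add_assoc]
  have hyk : w y ∈ LinearMap.ker (cornerMap P Q) := by
    rw [mem_ker_cornerMap, hy]
    fin_cases i <;> fin_cases j <;>
      simp [P, Q, smul_smul, ← mul_assoc, hab, add_left_comm _ (l q), ZModModule.add_self]
  rw [hxy, Set.image_pair]
  refine ⟨linearIndepOn_pair_of_det (by simp [x, y]) hdet, cornerMap P Q, cornerMap_surjective P Q,
    ker_cornerMap hxk hyk hdet, ?_⟩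
  ext1 v
  by_cases hvp : v = p
  · subst hvp
    rw [Function.comp_apply, Function.comp_apply, doubleCopy_left]
    fin_cases i <;> fin_cases j <;>
      simp [w, squareColoring, squareCorner, cornerMap_apply, shear, P, Q, ha, add_comm]
  · by_cases hvq : v = q
    · subst hvq
      rw [Function.comp_apply, Function.comp_apply, doubleCopy_right]
      fin_cases i <;> fin_cases j <;>
        simp [w, squareColoring, squareCorner, cornerMap_apply, shear, P, Q, hb, add_comm,
          mul_comm (b p), hab]
    · have hv : w (doubleCopy h i j v) = (a v, b v, l v) := by
        rw [doubleCopy_of_ne h i j hvp hvq]; rfl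
      rw [Function.comp_apply, Function.comp_apply, hv]
      fin_cases i <;> fin_cases j <;>
        simp [squareCorner, cornerMap_apply, shear, P, Q] <;> module

variable {K : AbstractSimplicialComplex V} {n : ℕ}

lemma exists_represents_squareColoring [Module.Finite (ZMod 2) U] (hn : 0 < n)
    (hK : ∀ s ∈ K.faces, s.card ≤ n) (hU : Module.finrank (ZMod 2) U = n)
    (ha : a p = 0) (hb : b q = 0) (hab : a q * b p = 0)
    (hc : ∀ i j, IsNonsingularColoring K n (squareCorner l p q a b i j)) :
    ∃ S : CM (doubleWedge K h) (n + 2), Represents S (squareColoring h l a b) := by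
  have hw : IsNonsingularColoring (doubleWedge K h) (n + 2) (squareColoring h l a b) := by
    refine isNonsingularColoring_doubleWedge (U := U) hn hK h fun i j => ?_
    obtain ⟨h1, π, -, h2, h3⟩ := squareColoring_projection (h := h) (l := l) ha hb hab i j
    exact ⟨h1, π, h2, h3 ▸ hc i j⟩
  refine hw.exists_represents ?_
  rw [Module.finrank_prod, Module.finrank_prod, hU, Module.finrank_self]
  omega

/-- The corners of the square represented by `squareColoring h l a b` are `squareCorner`. -/
lemma Represents.isProjection_squareColoring_iff (ha : a p = 0) (hb : b q = 0)
    (hab : a q * b p = 0) {S : CM (doubleWedge K h) (n + 2)}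
    (hS : Represents S (squareColoring h l a b)) (i j : Fin 2) {c : CM K n} :
    IsProjection (copiesEdge h (1 - i) (1 - j)) (doubleCopy h i j) S c ↔
      Represents c (squareCorner l p q a b i j) := by
  obtain ⟨-, π, h1, h2, h3⟩ := squareColoring_projection (h := h) (l := l) ha hb hab i j
  rw [isProjection_iff hS h1 h2, h3]

lemma Represents.isRealizedBy_squareColoring_iff (ha : a p = 0) (hb : b q = 0)
    (hab : a q * b p = 0) {S : CM (doubleWedge K h) (n + 2)}
    (hS : Represents S (squareColoring h l a b)) {c cα cβ cγ : CM K n} :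
    IsRealizedBy K h c cα cβ cγ S ↔ Represents c l ∧ Represents cα (shear l p a) ∧
      Represents cβ (shear l q b) ∧
      Represents cγ (shear (shear l p a) q (b + b p • a)) :=
  and_congr (hS.isProjection_squareColoring_iff ha hb hab 0 0)
    (and_congr (hS.isProjection_squareColoring_iff ha hb hab 1 0)
      (and_congr (hS.isProjection_squareColoring_iff ha hb hab 0 1)
        (hS.isProjection_squareColoring_iff ha hb hab 1 1)))

end Coloring

/-! ### Normal forms of realizable squares -/

section SquareNormalForm

variable {n k : ℕ} {K : AbstractSimplicialComplex (Fin n ⊕ Fin k)} {p q : Fin n ⊕ Fin k}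

/-- A functional on the space of colours of a double wedge vanishes if it vanishes at one copy of
`p`, at one copy of `q` and at the vertices `1, …, n` (or the other copies of these). -/
lemma Represents.functional_eq_zero_of_edge
    (hF : Finset.univ.map Function.Embedding.inl ∈ K.faces) {hqp : q ≠ p}
    {S : CM (doubleWedge K hqp) (n + 2)} {W : Type*} [AddCommGroup W] [Module (ZMod 2) W]
    {w : WedgeVertex (WedgeVertex (Fin n ⊕ Fin k) p) (keep hqp) → W} (hS : Represents S w)
    (i j : Fin 2) (f : W →ₗ[ZMod 2] ZMod 2)
    (hp : f (w (doubleCopy hqp (1 - i) j p)) = 0) (hq : f (w (doubleCopy hqp i (1 - j) q)) = 0)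
    (h : ∀ x : Fin n, f (w (doubleCopy hqp i j (Sum.inl x))) = 0) : f = 0 := by
  refine hS.functional_eq_zero (wedgeFace_mem _ j (wedgeFace_mem p i hF))
    (by simp [card_wedgeFace]) f fun v hv => ?_
  rw [← Finset.mem_coe, coe_wedgeFace_wedgeFace] at hv
  rcases hv with hv | ⟨u, hu, rfl⟩
  · rw [doubleCopy_left] at hp
    rw [doubleCopy_right] at hq
    simp only [copiesEdge, Finset.coe_insert, Finset.coe_singleton, Set.mem_insert_iff,
      Set.mem_singleton_iff] at hv
    rcases hv with rfl | rfl
    exacts [hp, hq]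
  · obtain ⟨x, -, rfl⟩ := Finset.mem_map.mp hu
    exact h x

/-- The coordinate functional at the vertex `p` of `ℤ₂ⁿ`, or zero if `p` is not one of
`1, …, n`. -/
def coordAt (p : Fin n ⊕ Fin k) : (Fin n → ZMod 2) →ₗ[ZMod 2] ZMod 2 :=
  Sum.elim (fun i => LinearMap.proj i) (fun _ => 0) p

lemma coordAt_single (p : Fin n ⊕ Fin k) (x : Fin n) :
    coordAt p (Pi.single x 1) = if p = Sum.inl x then 1 else 0 := by
  rcases p with i | j
  · simp [coordAt, Pi.single_apply]
  · simp [coordAt]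

/-- In suitable coordinates, the colouring of a double wedge sends `p₂` to `(1, 0, 0)`, `q₂` to
`(0, 1, 0)` and each of the vertices `1, …, n` (or its first copy) to a standard basis vector of
`ℤ₂ⁿ`, up to the first two coordinates, which are `1` exactly at `p` and at `q`, respectively. -/
lemma exists_represents_standard (hF : Finset.univ.map Function.Embedding.inl ∈ K.faces)
    (hqp : q ≠ p) (S : CM (doubleWedge K hqp) (n + 2)) :
    ∃ w : WedgeVertex (WedgeVertex (Fin n ⊕ Fin k) p) (keep hqp) →
        ZMod 2 × ZMod 2 × (Fin n → ZMod 2), Represents S w ∧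
      w (doubleCopy hqp 1 0 p) = (1, 0, 0) ∧ w (doubleCopy hqp 0 1 q) = (0, 1, 0) ∧
      ∀ x : Fin n, w (doubleCopy hqp 0 0 (Sum.inl x)) =
        (if p = Sum.inl x then 1 else 0, if q = Sum.inl x then 1 else 0, Pi.single x 1) := by
  obtain ⟨w, hw⟩ := CM.exists_represents S
  let P2 := w (doubleCopy hqp 1 0 p)
  let Q2 := w (doubleCopy hqp 0 1 q)
  let u : Fin n → Fin (n + 2) → ZMod 2 := fun x => w (doubleCopy hqp 0 0 (Sum.inl x))
  -- The coordinates are chosen through the inverse map, from `ℤ₂ × ℤ₂ × ℤ₂ⁿ`.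
  let T : ZMod 2 × ZMod 2 × (Fin n → ZMod 2) →ₗ[ZMod 2] (Fin (n + 2) → ZMod 2) :=
    LinearMap.coprod (LinearMap.toSpanSingleton _ _ P2)
      (LinearMap.coprod (LinearMap.toSpanSingleton _ _ Q2)
        (Fintype.linearCombination (ZMod 2) u + (coordAt p).smulRight P2 +
          (coordAt q).smulRight Q2))
  have hT : ∀ x y z, T (x, y, z) = x • P2 + (y • Q2 +
      (Fintype.linearCombination (ZMod 2) u z + coordAt p z • P2 + coordAt q z • Q2)) :=
    fun x y z => rfl
  have hTp : T (1, 0, 0) = P2 := by rw [hT]; simp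
  have hTq : T (0, 1, 0) = Q2 := by rw [hT]; simp
  have hTx : ∀ x, T (if p = Sum.inl x then 1 else 0, if q = Sum.inl x then 1 else 0,
      Pi.single x 1) = u x := by
    intro x
    rw [hT, coordAt_single, coordAt_single, Fintype.linearCombination_apply_single, one_smul]
    generalize (if p = Sum.inl x then (1 : ZMod 2) else 0) • P2 = A
    generalize (if q = Sum.inl x then (1 : ZMod 2) else 0) • Q2 = B
    trans (A + A) + (B + B) + u x
    · abel
    · simp [ZModModule.add_self]
  have hsurj : Function.Surjective T := by
    rw [← LinearMap.range_eq_top]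
    by_contra hne
    obtain ⟨f, hf, hle⟩ := Submodule.exists_le_ker_of_lt_top _ (lt_top_iff_ne_top.mpr hne)
    have hz : ∀ x, f (T x) = 0 := fun x => hle ⟨x, rfl⟩
    refine hf (hw.functional_eq_zero_of_edge hF 0 0 f ?_ ?_ fun x => ?_)
    · exact (congrArg f hTp).symm.trans (hz _)
    · exact (congrArg f hTq).symm.trans (hz _)
    · exact (congrArg f (hTx x)).symm.trans (hz _)
  have hinj : Function.Injective T :=
    (LinearMap.injective_iff_surjective_of_finrank_eq_finrank (by
      rw [Module.finrank_prod, Module.finrank_prod, Module.finrank_self, Module.finrank_fin_fun,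
        Module.finrank_fin_fun]; omega)).mpr hsurj
  let e := LinearEquiv.ofBijective T ⟨hinj, hsurj⟩
  have he : ∀ x, T x = e x := fun _ => rfl
  refine ⟨e.symm ∘ w, hw.map e.symm, ?_, ?_, fun x => ?_⟩ <;>
    rw [Function.comp_apply, LinearEquiv.symm_apply_eq, ← he]
  exacts [hTp.symm, hTq.symm, (hTx x).symm]

/-- Every realizable square is represented by some `squareColoring`, in which the colours of the
vertices `1, …, n` are the standard basis vectors. -/
lemma exists_represents_squareColoring_rowAt
    (hF : Finset.univ.map Function.Embedding.inl ∈ K.faces) (hqp : q ≠ p)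
    (S : CM (doubleWedge K hqp) (n + 2)) :
    ∃ (L : DualMatrix n k) (φ ψ : Fin k → ZMod 2), IsNormal L ∧ (rowAt φ p : ZMod 2) = 0 ∧
      (rowAt ψ q : ZMod 2) = 0 ∧ (rowAt φ q * rowAt ψ p : ZMod 2) = 0 ∧
      Represents S (squareColoring hqp (color L) (rowAt φ) (rowAt ψ)) := by
  obtain ⟨w, hw, hp2, hq2, hx⟩ := exists_represents_standard hF hqp S
  let d := doubleCopy hqp 0 0
  let M : Matrix (Fin n) (Fin k) (ZMod 2) := .of fun i j => (w (d (Sum.inr j))).2.2 i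
  let φ : Fin k → ZMod 2 := fun j => if Sum.inr j = p then 0 else (w (d (Sum.inr j))).1
  let ψ : Fin k → ZMod 2 := fun j => if Sum.inr j = q then 0 else (w (d (Sum.inr j))).2.1
  have hφp : (rowAt φ p : ZMod 2) = 0 := by
    rcases p with i | j <;> simp [rowAt, φ]
  have hψq : (rowAt ψ q : ZMod 2) = 0 := by
    rcases q with i | j <;> simp [rowAt, ψ]
  have hφ : ∀ v, v ≠ p → (w (d v)).1 = rowAt φ v := by
    rintro (i | j) hv
    · simp [d, hx, rowAt, hv.symm]
    · simp [rowAt, φ, hv]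
  have hψ : ∀ v, v ≠ q → (w (d v)).2.1 = rowAt ψ v := by
    rintro (i | j) hv
    · simp [d, hx, rowAt, hv.symm]
    · simp [rowAt, ψ, hv]
  have hl : ∀ v, (w (d v)).2.2 = color (fromRows M 1 : DualMatrix n k) v := by
    rintro (i | j)
    · simp [d, hx, color]
    · rfl
  have hd : ∀ (i j : Fin 2) v, v ≠ p → v ≠ q → doubleCopy hqp i j v = d v := by
    intro i j v h1 h2
    change _ = doubleCopy hqp 0 0 v
    rw [doubleCopy_of_ne hqp i j h1 h2, doubleCopy_of_ne hqp 0 0 h1 h2]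
  have hdp : ∀ i j : Fin 2, doubleCopy hqp i j p = doubleCopy hqp i 0 p := by
    intro i j
    rw [doubleCopy_left, doubleCopy_left]
  have hdq : ∀ i j : Fin 2, doubleCopy hqp i j q = doubleCopy hqp 0 j q := by
    intro i j
    rw [doubleCopy_right, doubleCopy_right]
  -- If `p` is not among `1, …, n`, the first coordinate does not vanish at `p₁`, since it vanishes
  -- at the other vertices of a facet that contains `p₁`.
  have hp1 : (w (d p)).1 = 1 := by
    rcases hp : p with i | j
    · simp [d, hx, hp]
    rw [← hp]
    by_contra h0
    have h0' := (eq_zero_or_eq_one _).resolve_right h0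
    have := hw.functional_eq_zero_of_edge hF 1 0 (LinearMap.fst _ _ _) h0'
      (by change (w (doubleCopy hqp 1 1 q)).1 = 0; rw [hdq, hq2]) fun x => by
        have hxp : Sum.inl x ≠ p := by simp [hp]
        have : doubleCopy hqp 1 0 (Sum.inl x) = d (Sum.inl x) := by
          by_cases hxq : Sum.inl x = q
          · rw [hxq, hdq]
          · exact hd _ _ _ hxp hxq
        rw [this]
        exact hφ _ hxp
    simpa using LinearMap.congr_fun this (1, 0, 0)
  have hq1 : (w (d q)).2.1 = 1 := by
    rcases hq : q with i | j
    · simp [d, hx, hq]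
    rw [← hq]
    by_contra h0
    have h0' := (eq_zero_or_eq_one _).resolve_right h0
    have := hw.functional_eq_zero_of_edge hF 0 1 (LinearMap.fst _ _ _ ∘ₗ LinearMap.snd _ _ _)
      (by change (w (doubleCopy hqp 1 1 p)).2.1 = 0; rw [hdp, hp2]) h0' fun x => by
        have hxq : Sum.inl x ≠ q := by simp [hq]
        have : doubleCopy hqp 0 1 (Sum.inl x) = d (Sum.inl x) := by
          by_cases hxp : Sum.inl x = p
          · rw [hxp, hdp]
          · exact hd _ _ _ hxp hxq
        rw [this]
        exact hψ _ hxq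
    simpa using LinearMap.congr_fun this (0, 1, 0)
  refine ⟨fromRows M 1, φ, ψ, ⟨M, rfl⟩, hφp, hψq, ?_, ?_⟩
  · by_contra hne
    -- The sum of the first two coordinates would vanish at `p₁`, `q₁` and `1, …, n`.
    have h1 := (eq_zero_or_eq_one _).resolve_left (left_ne_zero_of_mul hne)
    have h2 := (eq_zero_or_eq_one _).resolve_left (right_ne_zero_of_mul hne)
    have := hw.functional_eq_zero_of_edge hF 1 1
      (LinearMap.fst _ _ _ + LinearMap.fst _ _ _ ∘ₗ LinearMap.snd _ _ _)
      (by
        change (w (doubleCopy hqp 0 1 p)).1 + (w (doubleCopy hqp 0 1 p)).2.1 = 0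
        rw [hdp, hp1, hψ p hqp.symm, h2]; rfl)
      (by
        change (w (doubleCopy hqp 1 0 q)).1 + (w (doubleCopy hqp 1 0 q)).2.1 = 0
        rw [hdq, hq1, hφ q hqp, h1]; rfl)
      fun x => by
        have hxp : Sum.inl x ≠ p := by
          rintro rfl; simp [rowAt] at h2
        have hxq : Sum.inl x ≠ q := by
          rintro rfl; simp [rowAt] at h1
        rw [hd _ _ _ hxp hxq]
        change (w (d (Sum.inl x))).1 + (w (d (Sum.inl x))).2.1 = 0
        rw [hφ _ hxp, hψ _ hxq]
        rfl
    simpa using LinearMap.congr_fun this (1, 0, 0)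
  · have hfin : ∀ i : Fin 2, i = 0 ∨ i = 1 := by decide
    convert hw using 1
    ext1 v
    rcases v with ⟨v | i, hv⟩ | j
    · have hvq : v.1 ≠ q := fun h => hv (by simp [← h])
      rw [← doubleCopy_of_ne hqp 0 0 v.2 hvq]
      change _ = w (d v.1)
      rw [doubleCopy_of_ne hqp 0 0 v.2 hvq]
      exact (Prod.ext (hφ v.1 v.2) (Prod.ext (hψ v.1 hvq) (hl v.1))).symm
    · rw [show w (Sum.inl ⟨Sum.inr i, hv⟩) = w (doubleCopy hqp i 0 p) by rw [doubleCopy_left]]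
      rcases hfin i with rfl | rfl
      · exact (Prod.ext hp1 (Prod.ext (hψ p hqp.symm) (hl p))).symm
      · exact hp2.symm
    · rcases hfin j with rfl | rfl
      · rw [show w (Sum.inr 0) = w (d q) by rw [← doubleCopy_right hqp 0 0]]
        exact (Prod.ext (hφ q hqp) (Prod.ext hq1 (hl q))).symm
      · rw [show w (Sum.inr 1) = (0, 1, 0) by rw [← doubleCopy_right hqp 0 1, hq2]]
        rfl

end SquareNormalForm

/-! ### Realizable squares and missing pieces -/

section MissingPiece

variable {n k : ℕ} {K : AbstractSimplicialComplex (Fin n ⊕ Fin k)} {p q : Fin n ⊕ Fin k}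

lemma IsProjection.unique {V V' : Type*} {K' : AbstractSimplicialComplex V'}
    {K : AbstractSimplicialComplex V} {N n : ℕ} {σ : Finset V'} {ι : V → V'} {C : CM K' N}
    {c c' : CM K n} (h : IsProjection σ ι C c) (h' : IsProjection σ ι C c') : c = c' := by
  obtain ⟨w, hw⟩ := CM.exists_represents C
  rw [isProjection_iff hw (Submodule.mkQ_surjective _) (Submodule.ker_mkQ _)] at h h'
  exact h.unique h'

/-- A class over a double wedge is a square with corners `c`, `cα`, `cβ`, `cγ` if and only if it is
the class of the explicit colouring given by the normal form of `c` and two row vectors `φ`, `ψ`,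
and the normal forms of the other corners are given by the explicit formulas. -/
lemma isRealizedBy_iff (hF : Finset.univ.map Function.Embedding.inl ∈ K.faces) {hqp : q ≠ p}
    {c cα cβ cγ : CM K n} {S : CM (doubleWedge K hqp) (n + 2)} :
    IsRealizedBy K hqp c cα cβ cγ S ↔ ∃ φ ψ : Fin k → ZMod 2, (rowAt φ p : ZMod 2) = 0 ∧
      (rowAt ψ q : ZMod 2) = 0 ∧ (rowAt φ q * rowAt ψ p : ZMod 2) = 0 ∧
      Represents S (squareColoring hqp (color (dualMatrix c)) (rowAt φ) (rowAt ψ)) ∧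
      dualMatrix cα = edgeMatrix (dualMatrix c) p φ * dualMatrix c ∧
      dualMatrix cβ = edgeMatrix (dualMatrix c) q ψ * dualMatrix c ∧
      dualMatrix cγ = fourthCorner (dualMatrix c) p q φ ψ := by
  constructor
  · intro h
    obtain ⟨L, φ, ψ, hL, hφ, hψ, hφψ, hS⟩ := exists_represents_squareColoring_rowAt hF hqp S
    obtain ⟨h0, hα, hβ, hγ⟩ := (hS.isRealizedBy_squareColoring_iff hφ hψ hφψ).mp h
    obtain rfl := h0.dualMatrix_eq hF hL
    refine ⟨φ, ψ, hφ, hψ, hφψ, hS, ?_, ?_, ?_⟩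
    · rw [dualMatrix_eq_iff hF (hL.edgeMatrix_mul _ _ _), hL.color_edgeMatrix_mul]
      exact hα
    · rw [dualMatrix_eq_iff hF (hL.edgeMatrix_mul _ _ _), hL.color_edgeMatrix_mul]
      exact hβ
    · rw [dualMatrix_eq_iff hF (hL.fourthCorner _ _ _ _), hL.color_fourthCorner]
      exact hγ
  · rintro ⟨φ, ψ, hφ, hψ, hφψ, hS, hα, hβ, hγ⟩
    have hL := isNormal_dualMatrix c
    rw [dualMatrix_eq_iff hF (hL.edgeMatrix_mul _ _ _), hL.color_edgeMatrix_mul] at hα hβ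
    rw [dualMatrix_eq_iff hF (hL.fourthCorner _ _ _ _), hL.color_fourthCorner] at hγ
    exact (hS.isRealizedBy_squareColoring_iff hφ hψ hφψ).mpr
      ⟨represents_color_dualMatrix hF c, hα, hβ, hγ⟩

/-- If `λ'(v) = λ(v) + φ(v) λ(p)` for all `v`, then `φ(p) = 0`, since `λ'(p) ≠ 0`. -/
lemma rowAt_eq_zero (hK : IsPure K n) (hF : Finset.univ.map Function.Embedding.inl ∈ K.faces)
    {c c' : CM K n} {φ : Fin k → ZMod 2}
    (h : dualMatrix c' = edgeMatrix (dualMatrix c) p φ * dualMatrix c) :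
    (rowAt φ p : ZMod 2) = 0 := by
  have h0 := color_dualMatrix_ne_zero hK hF c' p
  rw [h, (isNormal_dualMatrix c).color_edgeMatrix_mul, shear] at h0
  refine (eq_zero_or_eq_one _).resolve_right fun h1 => h0 ?_
  rw [h1, one_smul, ZModModule.add_self]

lemma edgeMatrix_mul_inj (hK : IsPure K n)
    (hF : Finset.univ.map Function.Embedding.inl ∈ K.faces) {c : CM K n} {φ φ' : Fin k → ZMod 2}
    (h : edgeMatrix (dualMatrix c) p φ * dualMatrix c =
      edgeMatrix (dualMatrix c) p φ' * dualMatrix c) : φ = φ' := by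
  ext1 j
  have h1 := congrFun (congrArg color h) (Sum.inr j)
  rw [(isNormal_dualMatrix c).color_edgeMatrix_mul, (isNormal_dualMatrix c).color_edgeMatrix_mul,
    shear, shear, add_right_inj] at h1
  exact smul_left_injective _ (color_dualMatrix_ne_zero hK hF c p) h1

lemma rowAt_mul_eq_zero (hK : IsPure K n)
    (hF : Finset.univ.map Function.Embedding.inl ∈ K.faces)
    {c cα cβ cγ : CM K n} {φ ψ : Fin k → ZMod 2}
    (hα : dualMatrix cα = edgeMatrix (dualMatrix c) p φ * dualMatrix c)
    (hβ : dualMatrix cβ = edgeMatrix (dualMatrix c) q ψ * dualMatrix c)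
    (hγ : dualMatrix cγ = fourthCorner (dualMatrix c) p q φ ψ) :
    (rowAt φ q * rowAt ψ p : ZMod 2) = 0 := by
  rw [fourthCorner, ← hα] at hγ
  have := rowAt_eq_zero hK hF hγ
  rw [rowAt_add_smul, Pi.add_apply, rowAt_eq_zero hK hF hβ, zero_add] at this
  rw [mul_comm]
  exact this

/-- The square with prescribed corners exists as soon as these are related by the explicit
formulas. -/
lemma exists_isRealizedBy (hK : IsPure K n)
    (hF : Finset.univ.map Function.Embedding.inl ∈ K.faces) (hqp : q ≠ p)
    {c cα cβ cγ : CM K n} {φ ψ : Fin k → ZMod 2}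
    (hα : dualMatrix cα = edgeMatrix (dualMatrix c) p φ * dualMatrix c)
    (hβ : dualMatrix cβ = edgeMatrix (dualMatrix c) q ψ * dualMatrix c)
    (hγ : dualMatrix cγ = fourthCorner (dualMatrix c) p q φ ψ) :
    ∃ S, IsRealizedBy K hqp c cα cβ cγ S := by
  have hL := isNormal_dualMatrix c
  have h1 := rowAt_eq_zero hK hF hα
  have h2 := rowAt_eq_zero hK hF hβ
  have h3 := rowAt_mul_eq_zero hK hF hα hβ hγ
  obtain ⟨S, hS⟩ : ∃ S : CM (doubleWedge K hqp) (n + 2),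
      Represents S (squareColoring hqp (color (dualMatrix c)) (rowAt φ) (rowAt ψ)) := by
    refine exists_represents_squareColoring (pos_of_univ_mem_faces hF) (fun s hs => (hK s hs).1)
      (by simp) h1 h2 h3 fun i j => ?_
    have g0 := isNonsingularColoring_color hF c
    have g1 := isNonsingularColoring_color hF cα
    have g2 := isNonsingularColoring_color hF cβ
    have g3 := isNonsingularColoring_color hF cγ
    rw [hα, hL.color_edgeMatrix_mul] at g1
    rw [hβ, hL.color_edgeMatrix_mul] at g2
    rw [hγ, hL.color_fourthCorner] at g3
    fin_cases i <;> fin_cases j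
    exacts [g0, g2, g1, g3]
  exact ⟨S, (isRealizedBy_iff hF).mpr ⟨φ, ψ, h1, h2, h3, hS, hα, hβ, hγ⟩⟩

lemma IsRealizedBy.unique (hK : IsPure K n)
    (hF : Finset.univ.map Function.Embedding.inl ∈ K.faces) {hqp : q ≠ p}
    {c cα cβ cγ : CM K n} {S S' : CM (doubleWedge K hqp) (n + 2)}
    (h : IsRealizedBy K hqp c cα cβ cγ S) (h' : IsRealizedBy K hqp c cα cβ cγ S') : S = S' := by
  obtain ⟨φ, ψ, -, -, -, hS, hα, hβ, -⟩ := (isRealizedBy_iff hF).mp h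
  obtain ⟨φ', ψ', -, -, -, hS', hα', hβ', -⟩ := (isRealizedBy_iff hF).mp h'
  obtain rfl := edgeMatrix_mul_inj hK hF (hα.symm.trans hα')
  obtain rfl := edgeMatrix_mul_inj hK hF (hβ.symm.trans hβ')
  exact hS.unique hS'

/-- Every class over the double wedge is a square: its four projections exist. -/
lemma exists_corners (hF : Finset.univ.map Function.Embedding.inl ∈ K.faces) {hqp : q ≠ p}
    (S : CM (doubleWedge K hqp) (n + 2)) :
    ∃ c cα cβ cγ : CM K n, IsRealizedBy K hqp c cα cβ cγ S := by
  obtain ⟨L, φ, ψ, hL, hφ, hψ, hφψ, hS⟩ := exists_represents_squareColoring_rowAt hF hqp S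
  have h : ∀ i j, ∃ c : CM K n,
      Represents c (squareCorner (color L) p q (rowAt φ) (rowAt ψ) i j) := by
    intro i j
    refine IsNonsingularColoring.exists_represents (fun s hs hc => ?_) (by simp)
    obtain ⟨h1, π, -, h2, h3⟩ :=
      squareColoring_projection (h := hqp) (l := color L) hφ hψ hφψ i j
    rw [← h3, ← linearIndepOn_union_image_iff h1 h2 (doubleCopy_injective hqp i j)
      (disjoint_copiesEdge hqp i j _)]
    exact hS.nonsingular.linearIndepOn_doubleWedge i j hs hc
  obtain ⟨c, hc⟩ := h 0 0
  obtain ⟨cα, hα⟩ := h 1 0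
  obtain ⟨cβ, hβ⟩ := h 0 1
  obtain ⟨cγ, hγ⟩ := h 1 1
  exact ⟨c, cα, cβ, cγ, (hS.isRealizedBy_squareColoring_iff hφ hψ hφψ).mpr ⟨hc, hα, hβ, hγ⟩⟩

/-- The fourth corner does not depend on the order in which the two edges are followed. -/
lemma IsNormal.fourthCorner_comm {L : DualMatrix n k} (hL : IsNormal L) {φ ψ : Fin k → ZMod 2}
    (h : (rowAt φ q * rowAt ψ p : ZMod 2) = 0) :
    Puzzle.fourthCorner L p q φ ψ = Puzzle.fourthCorner L q p ψ φ := by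
  refine (hL.fourthCorner _ _ _ _).ext (hL.fourthCorner _ _ _ _) ?_
  rw [hL.color_fourthCorner, hL.color_fourthCorner]
  ext1 v
  simp only [shear, Pi.add_apply, Pi.smul_apply, smul_eq_mul, add_smul, smul_add, smul_smul]
  rw [show (rowAt ψ v + rowAt ψ p * rowAt φ v) * rowAt φ q = rowAt ψ v * rowAt φ q by
      linear_combination rowAt φ v * h,
    show (rowAt φ v + rowAt φ q * rowAt ψ v) * rowAt ψ p = rowAt φ v * rowAt ψ p by
      linear_combination rowAt ψ v * h]
  module

lemma IsNormal.fourthCorner_eq_mul {L : DualMatrix n k} (hL : IsNormal L) {φ ψ : Fin k → ZMod 2}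
    (h : (rowAt φ q : ZMod 2) = 0) (h' : (rowAt ψ p : ZMod 2) = 0) :
    Puzzle.fourthCorner L p q φ ψ = edgeMatrix L p φ * (edgeMatrix L q ψ * L) := by
  refine (hL.fourthCorner _ _ _ _).ext ((hL.edgeMatrix_mul _ _ _).edgeMatrix_mul _ _ _) ?_
  ext1 v
  rw [hL.color_fourthCorner, (hL.edgeMatrix_mul _ _ _).color_edgeMatrix_mul',
    hL.color_edgeMatrix_mul]
  simp only [shear, Pi.add_apply, Pi.zero_apply, h, h', zero_smul, add_zero]
  module

/-- The missing piece of an incomplete square is the class given by the explicit formula. -/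
lemma isMissingPiece_iff (hK : IsPure K n)
    (hF : Finset.univ.map Function.Embedding.inl ∈ K.faces) {hqp : q ≠ p}
    {c cα cβ cγ : CM K n} {φ ψ : Fin k → ZMod 2}
    (hα : dualMatrix cα = edgeMatrix (dualMatrix c) p φ * dualMatrix c)
    (hβ : dualMatrix cβ = edgeMatrix (dualMatrix c) q ψ * dualMatrix c) :
    IsMissingPiece K hqp c cα cβ cγ ↔ dualMatrix cγ = fourthCorner (dualMatrix c) p q φ ψ := by
  constructor
  · rintro ⟨-, S, hS⟩
    obtain ⟨φ', ψ', -, -, -, -, hα', hβ', hγ'⟩ := (isRealizedBy_iff hF).mp hS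
    obtain rfl := edgeMatrix_mul_inj hK hF (hα.symm.trans hα')
    obtain rfl := edgeMatrix_mul_inj hK hF (hβ.symm.trans hβ')
    exact hγ'
  · intro hγ
    refine ⟨⟨?_, ?_⟩, exists_isRealizedBy hK hF hqp hα hβ hγ⟩
    · rw [fourthCorner, ← hα] at hγ
      exact (isEdge_iff hK hF).mpr ⟨_, rowAt_eq_zero hK hF hγ, hγ⟩
    · rw [(isNormal_dualMatrix c).fourthCorner_comm (rowAt_mul_eq_zero hK hF hα hβ hγ),
        fourthCorner, ← hβ] at hγ
      exact (isEdge_iff hK hF).mpr ⟨_, rowAt_eq_zero hK hF hγ, hγ⟩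

lemma IsRealizedBy.isMissingPiece (hK : IsPure K n)
    (hF : Finset.univ.map Function.Embedding.inl ∈ K.faces) {hqp : q ≠ p}
    {c cα cβ cγ : CM K n} {S : CM (doubleWedge K hqp) (n + 2)}
    (h : IsRealizedBy K hqp c cα cβ cγ S) : IsMissingPiece K hqp c cα cβ cγ := by
  obtain ⟨φ, ψ, -, -, -, -, hα, hβ, hγ⟩ := (isRealizedBy_iff hF).mp h
  exact (isMissingPiece_iff hK hF hα hβ).mpr hγ

/-- If `λ(p) = λ(q)`, then `φ(q) = 0`, since `λ'(q) ≠ 0`. -/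
lemma rowAt_eq_zero_of_color_eq (hK : IsPure K n)
    (hF : Finset.univ.map Function.Embedding.inl ∈ K.faces)
    {c c' : CM K n} {φ : Fin k → ZMod 2}
    (h : dualMatrix c' = edgeMatrix (dualMatrix c) p φ * dualMatrix c)
    (hpq : color (dualMatrix c) p = color (dualMatrix c) q) :
    (rowAt φ q : ZMod 2) = 0 := by
  have h0 := color_dualMatrix_ne_zero hK hF c' q
  rw [h, (isNormal_dualMatrix c).color_edgeMatrix_mul, shear, hpq] at h0
  refine (eq_zero_or_eq_one _).resolve_right fun h1 => h0 ?_
  rw [h1, one_smul, ZModModule.add_self]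

/-- If `λ(p) = λ(q)`, then the fourth corner is `λ + λ(p) (φ + ψ)`, which is non-singular because
`λ + λ(p) φ` and `λ + λ(p) ψ` are. -/
lemma exists_fourthCorner_of_color_eq (hK : IsPure K n)
    (hF : Finset.univ.map Function.Embedding.inl ∈ K.faces)
    {c cα cβ : CM K n} {φ ψ : Fin k → ZMod 2}
    (hα : dualMatrix cα = edgeMatrix (dualMatrix c) p φ * dualMatrix c)
    (hβ : dualMatrix cβ = edgeMatrix (dualMatrix c) q ψ * dualMatrix c)
    (hpq : color (dualMatrix c) p = color (dualMatrix c) q) :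
    ∃ cγ : CM K n, dualMatrix cγ = fourthCorner (dualMatrix c) p q φ ψ := by
  have hL := isNormal_dualMatrix c
  have h1 := rowAt_eq_zero_of_color_eq hK hF hα hpq
  have h2 := rowAt_eq_zero_of_color_eq hK hF hβ hpq.symm
  have hshear : ∀ a : Fin n ⊕ Fin k → ZMod 2,
      shear (color (dualMatrix c)) q a = shear (color (dualMatrix c)) p a := by
    intro a
    ext1 v
    rw [shear, shear, hpq]
  refine exists_dualMatrix_eq hF (hL.fourthCorner _ _ _ _) ?_
  have g1 := isNonsingularColoring_color hF cα
  have g2 := isNonsingularColoring_color hF cβ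
  rw [hα, hL.color_edgeMatrix_mul] at g1
  rw [hβ, hL.color_edgeMatrix_mul, hshear] at g2
  convert (isNonsingularColoring_color hF c).shear_add (by simp) g1 g2 using 1
  rw [hL.color_fourthCorner]
  ext1 v
  simp only [shear, Pi.add_apply, Pi.zero_apply, h1, h2, hpq, zero_smul, add_zero]
  module

lemma smul_add_smul_inj {W : Type*} [AddCommGroup W] [Module (ZMod 2) W] {x y : W} (hx : x ≠ 0)
    (hy : y ≠ 0) (hxy : x ≠ y) {s t s' t' : ZMod 2} (h : s • x + t • y = s' • x + t' • y) :
    s = s' ∧ t = t' := by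
  have h1 : (s + s') • x + (t + t') • y = 0 := by
    trans (s • x + t • y) + (s' • x + t' • y)
    · module
    · rw [h, ZModModule.add_self]
  rw [← CharTwo.add_eq_zero, ← CharTwo.add_eq_zero (a := t)]
  rcases eq_zero_or_eq_one (s + s') with hs | hs <;>
    rcases eq_zero_or_eq_one (t + t') with ht | ht
  · exact ⟨hs, ht⟩
  · simp [hs, ht, hy] at h1
  · simp [hs, ht, hx] at h1
  · rw [hs, ht, one_smul, one_smul, ← ZModModule.sub_eq_add, sub_eq_zero] at h1
    exact absurd h1 hxy

/-- If `λ(p) ≠ λ(q)`, then comparing the coefficients of `λ(p)` and of `λ(q)` in the two expressions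
of a possible missing piece shows that it is the fourth corner. -/
lemma IsPossibleMissingPiece.dualMatrix_eq (hK : IsPure K n)
    (hF : Finset.univ.map Function.Embedding.inl ∈ K.faces)
    {c cα cβ cγ : CM K n} {φ ψ : Fin k → ZMod 2}
    (hα : dualMatrix cα = edgeMatrix (dualMatrix c) p φ * dualMatrix c)
    (hβ : dualMatrix cβ = edgeMatrix (dualMatrix c) q ψ * dualMatrix c)
    (hpq : color (dualMatrix c) p ≠ color (dualMatrix c) q)
    (h : IsPossibleMissingPiece K p q cα cβ cγ) :
    dualMatrix cγ = fourthCorner (dualMatrix c) p q φ ψ := by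
  obtain ⟨h1, h2⟩ := h
  obtain ⟨χ, -, h1⟩ := (isEdge_iff hK hF).mp h1
  obtain ⟨ω, hω, h2⟩ := (isEdge_iff hK hF).mp h2
  have hL := isNormal_dualMatrix c
  have hφ := rowAt_eq_zero hK hF hα
  have key : ∀ v : Fin n ⊕ Fin k, (rowAt φ v + rowAt χ v * rowAt φ q : ZMod 2) = rowAt ω v ∧
      (rowAt χ v : ZMod 2) = rowAt ψ v + rowAt ω v * rowAt ψ p := by
    intro v
    refine smul_add_smul_inj (color_dualMatrix_ne_zero hK hF c p)
      (color_dualMatrix_ne_zero hK hF c q) hpq ?_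
    have h3 := congrFun (congrArg color (h1.symm.trans h2)) v
    rw [(isNormal_dualMatrix cα).color_edgeMatrix_mul,
      (isNormal_dualMatrix cβ).color_edgeMatrix_mul, hα, hβ, hL.color_edgeMatrix_mul,
      hL.color_edgeMatrix_mul] at h3
    simp only [shear] at h3
    rw [add_assoc, add_assoc, add_right_inj] at h3
    calc _ = rowAt φ v • color (dualMatrix c) p + rowAt χ v •
          (color (dualMatrix c) q + rowAt φ q • color (dualMatrix c) p) := by module
      _ = _ := h3
      _ = _ := by module
  -- At `v = p`, the two equations give `φ(q) ψ(p) = 0`.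
  have hpp := key p
  rw [hφ, hω, zero_add, zero_mul, add_zero] at hpp
  have h0 : (rowAt φ q * rowAt ψ p : ZMod 2) = 0 := by
    rw [mul_comm, ← hpp.2, hpp.1]
  have hχ : (rowAt χ : Fin n ⊕ Fin k → ZMod 2) = rowAt ψ + rowAt ψ p • rowAt φ := by
    ext1 v
    obtain ⟨e1, e2⟩ := key v
    rw [← e1] at e2
    rw [e2, Pi.add_apply, Pi.smul_apply, smul_eq_mul, add_mul, mul_assoc, h0]
    ring
  refine (isNormal_dualMatrix cγ).ext (hL.fourthCorner _ _ _ _) ?_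
  rw [h1, (isNormal_dualMatrix cα).color_edgeMatrix_mul, hα, hL.color_edgeMatrix_mul,
    hL.color_fourthCorner, hχ]

lemma exists_isMissingPiece (hK : IsPure K n)
    (hF : Finset.univ.map Function.Embedding.inl ∈ K.faces) {hqp : q ≠ p}
    {c cα cβ : CM K n} (h : IsIncompleteSquare K p q c cα cβ)
    (h' : ∃ cγ, IsPossibleMissingPiece K p q cα cβ cγ) :
    ∃ cγ, IsMissingPiece K hqp c cα cβ cγ := by
  obtain ⟨φ, -, hα⟩ := (isEdge_iff hK hF).mp h.1
  obtain ⟨ψ, -, hβ⟩ := (isEdge_iff hK hF).mp h.2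
  simp only [isMissingPiece_iff hK hF hα hβ]
  by_cases hpq : color (dualMatrix c) p = color (dualMatrix c) q
  · exact exists_fourthCorner_of_color_eq hK hF hα hβ hpq
  · exact h'.imp fun cγ hγ => hγ.dualMatrix_eq hK hF hα hβ hpq

/-- The four dual matrices of the corners identify the classes over the double wedge with the
explicit list of squares. -/
lemma exists_equiv_explicitSquares (hK : IsPure K n)
    (hF : Finset.univ.map Function.Embedding.inl ∈ K.faces) (hqp : q ≠ p)
    (D : Finset (DualMatrix n k)) (hD : ∀ L, L ∈ D ↔ ∃ c : CM K n, dualMatrix c = L) :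
    ∃ f : CM (doubleWedge K hqp) (n + 2) ≃ {x // x ∈ explicitSquares D p q},
      ∀ S c cα cβ cγ, IsRealizedBy K hqp c cα cβ cγ S ↔
        (f S).1 = (dualMatrix c, dualMatrix cα, dualMatrix cβ, dualMatrix cγ) := by
  have hmem : ∀ c : CM K n, dualMatrix c ∈ D := fun c => (hD _).mpr ⟨c, rfl⟩
  have hinj := dualMatrix_injective hF
  have hf : ∀ S : CM (doubleWedge K hqp) (n + 2), ∃ x : {x // x ∈ explicitSquares D p q},
      ∀ c cα cβ cγ, IsRealizedBy K hqp c cα cβ cγ S ↔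
        x.1 = (dualMatrix c, dualMatrix cα, dualMatrix cβ, dualMatrix cγ) := by
    intro S
    obtain ⟨c, cα, cβ, cγ, hS⟩ := exists_corners hF S
    obtain ⟨φ, ψ, -, -, -, -, hα, hβ, hγ⟩ := (isRealizedBy_iff hF).mp hS
    refine ⟨⟨(dualMatrix c, dualMatrix cα, dualMatrix cβ, dualMatrix cγ), ?_⟩, ?_⟩
    · refine Finset.mem_filter.mpr ⟨?_, φ, ψ, hα, hβ, hγ⟩
      simp only [Finset.mem_product]
      exact ⟨hmem _, hmem _, hmem _, hmem _⟩
    · intro d dα dβ dγ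
      simp only [Prod.mk.injEq, hinj.eq_iff]
      constructor
      · rintro ⟨h0, h1, h2, h3⟩
        exact ⟨hS.1.unique h0, hS.2.1.unique h1, hS.2.2.1.unique h2, hS.2.2.2.unique h3⟩
      · rintro ⟨rfl, rfl, rfl, rfl⟩
        exact hS
  choose f hf using hf
  refine ⟨Equiv.ofBijective f ⟨fun S S' h => ?_, fun x => ?_⟩, hf⟩
  · obtain ⟨c, cα, cβ, cγ, hS⟩ := exists_corners hF S
    exact hS.unique hK hF ((hf S' _ _ _ _).mpr (h ▸ (hf S _ _ _ _).mp hS))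
  · obtain ⟨⟨L, Lα, Lβ, Lγ⟩, hx⟩ := x
    obtain ⟨hx1, φ, ψ, hα, hβ, hγ⟩ := Finset.mem_filter.mp hx
    simp only [Finset.mem_product] at hx1
    obtain ⟨⟨c, rfl⟩, ⟨cα, rfl⟩, ⟨cβ, rfl⟩, ⟨cγ, rfl⟩⟩ :=
      hx1.imp (hD _).mp (And.imp (hD _).mp (And.imp (hD _).mp (hD _).mp))
    obtain ⟨S, hS⟩ := exists_isRealizedBy hK hF hqp hα hβ hγ
    exact ⟨S, Subtype.ext ((hf S _ _ _ _).mp hS)⟩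

end MissingPiece

end Puzzle

theorem mainTheorem3 {n k : ℕ} (K : AbstractSimplicialComplex (Fin n ⊕ Fin k)) (hK : IsPure K n)
    (hF : Finset.univ.map Function.Embedding.inl ∈ K.faces)
    (p q : Fin n ⊕ Fin k) (hqp : q ≠ p) :
    -- completing an incomplete `pq`-square
    (∀ c cα cβ : CM K n, IsIncompleteSquare K p q c cα cβ →
      -- no possible missing piece: there is no realizable square with these three corners
      ((¬ ∃ cγ, IsPossibleMissingPiece K p q cα cβ cγ) →
        ¬ ∃ cγ S, IsRealizedBy K hqp c cα cβ cγ S) ∧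
      -- otherwise there is exactly one missing piece, in exactly one realizable square
      ((∃ cγ, IsPossibleMissingPiece K p q cα cβ cγ) →
        ∃! cγ, IsMissingPiece K hqp c cα cβ cγ) ∧
      (∀ cγ, IsMissingPiece K hqp c cα cβ cγ → ∃! S, IsRealizedBy K hqp c cα cβ cγ S) ∧
      -- a single possible missing piece is the missing piece
      (∀ cγ, IsPossibleMissingPiece K p q cα cβ cγ →
        (∀ c', IsPossibleMissingPiece K p q cα cβ c' → c' = cγ) →
        IsMissingPiece K hqp c cα cβ cγ) ∧
      -- several possible missing pieces occur only if `λ(p) = λ(q)`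
      (∀ c₁ c₂, IsPossibleMissingPiece K p q cα cβ c₁ → IsPossibleMissingPiece K p q cα cβ c₂ →
        c₁ ≠ c₂ → color (dualMatrix c) p = color (dualMatrix c) q) ∧
      -- explicit formulas, in terms of the unique row vectors `φ`, `ψ` of the two given edges
      ∃ φ ψ : Fin k → ZMod 2,
        (∀ φ', dualMatrix cα = edgeMatrix (dualMatrix c) p φ' * dualMatrix c ↔ φ' = φ) ∧
        (∀ ψ', dualMatrix cβ = edgeMatrix (dualMatrix c) q ψ' * dualMatrix c ↔ ψ' = ψ) ∧
        (∀ cγ, IsMissingPiece K hqp c cα cβ cγ ↔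
          dualMatrix cγ = fourthCorner (dualMatrix c) p q φ ψ) ∧
        (color (dualMatrix c) p = color (dualMatrix c) q →
          ∃ cγ, IsMissingPiece K hqp c cα cβ cγ ∧
            dualMatrix cγ = edgeMatrix (dualMatrix c) p φ *
              (edgeMatrix (dualMatrix c) q ψ * dualMatrix c)) ∧
        (∀ i j : Fin n, p = Sum.inl i → q = Sum.inl j →
          ∀ cγ, IsMissingPiece K hqp c cα cβ cγ →
            dualMatrix cγ = edgeMatrix (dualMatrix c) p φ *
              (edgeMatrix (dualMatrix c) q ψ * dualMatrix c))) ∧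
    -- `CM(K)` is faithfully encoded by the set `D` of its normal forms, and `D` alone gives all the
    -- realizable squares
    Function.Injective (dualMatrix (K := K)) ∧
    (∀ D : Finset (DualMatrix n k), (∀ L, L ∈ D ↔ ∃ c : CM K n, dualMatrix c = L) →
      ∃ f : CM (doubleWedge K hqp) (n + 2) ≃ {x // x ∈ explicitSquares D p q},
        ∀ S c cα cβ cγ, IsRealizedBy K hqp c cα cβ cγ S ↔
          (f S).1 = (dualMatrix c, dualMatrix cα, dualMatrix cβ, dualMatrix cγ)) := by
  refine ⟨fun c cα cβ h => ?_, dualMatrix_injective hF,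
    fun D hD => exists_equiv_explicitSquares hK hF hqp D hD⟩
  obtain ⟨φ, hφ, hα⟩ := (isEdge_iff hK hF).mp h.1
  obtain ⟨ψ, hψ, hβ⟩ := (isEdge_iff hK hF).mp h.2
  have hiff : ∀ cγ, IsMissingPiece K hqp c cα cβ cγ ↔
      dualMatrix cγ = fourthCorner (dualMatrix c) p q φ ψ :=
    fun cγ => isMissingPiece_iff hK hF hα hβ
  refine ⟨?_, ?_, ?_, ?_, ?_, φ, ψ, ?_, ?_, hiff, ?_, ?_⟩
  · rintro hno ⟨cγ, S, hS⟩
    exact hno ⟨cγ, (hS.isMissingPiece hK hF).1⟩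
  · intro hex
    obtain ⟨cγ, hγ⟩ := exists_isMissingPiece (hqp := hqp) hK hF h hex
    refine ⟨cγ, hγ, fun c' hc' => dualMatrix_injective hF ?_⟩
    rw [(hiff _).mp hc', (hiff _).mp hγ]
  · rintro cγ ⟨-, S, hS⟩
    exact ⟨S, hS, fun S' hS' => IsRealizedBy.unique hK hF hS' hS⟩
  · intro cγ hγ hall
    obtain ⟨c', hc'⟩ := exists_isMissingPiece (hqp := hqp) hK hF h ⟨cγ, hγ⟩
    rwa [← hall c' hc'.1]
  · intro c₁ c₂ h₁ h₂ hne
    by_contra hpq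
    exact hne (dualMatrix_injective hF ((h₁.dualMatrix_eq hK hF hα hβ hpq).trans
      (h₂.dualMatrix_eq hK hF hα hβ hpq).symm))
  · exact fun φ' => ⟨fun h' => edgeMatrix_mul_inj hK hF (h'.symm.trans hα), fun h' => h' ▸ hα⟩
  · exact fun ψ' => ⟨fun h' => edgeMatrix_mul_inj hK hF (h'.symm.trans hβ), fun h' => h' ▸ hβ⟩
  · intro hpq
    obtain ⟨cγ, hγ⟩ := exists_fourthCorner_of_color_eq hK hF hα hβ hpq
    refine ⟨cγ, (hiff cγ).mpr hγ, hγ.trans ?_⟩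
    exact (isNormal_dualMatrix c).fourthCorner_eq_mul
      (rowAt_eq_zero_of_color_eq hK hF hα hpq) (rowAt_eq_zero_of_color_eq hK hF hβ hpq.symm)
  · rintro i j rfl rfl cγ hγ
    exact ((hiff cγ).mp hγ).trans ((isNormal_dualMatrix c).fourthCorner_eq_mul rfl rfl)
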